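/- **Theorem (EFO Completeness).** Let $[\cdot]$ be a normalization operator that maps EFO terms to EFO terms. Then every finite EFO branch is refutable in the tableau calculus $\mathcal T_{\mathrm{EFO}}$ or has a standard model. *Terms.* The base types are $o$ (truth values) and countably many *sorts* $\alpha$; if $\sigma,\tau$ are types, so is $\sigma\tau$ (functions from $\sigma$ to $\tau$). There are countably infinitely many variables of each type, and the logical constants $\neg:oo$, $\to:ooo$, $=_\sigma:\sigma\sigma o$ (all types $\sigma$) and $\forall_\alpha:(\alpha o)o$ (all sorts $\alpha$); variables and logical constants are the *names*. Terms are the simply typed terms built from names by application and by abstraction $\lambda x.t$ over a name $x$. Formulas are terms of type $o$, and $s\ne t$ is $\neg(s=t)$. A *frame* assigns to each type $\sigma$ a nonempty set $\mathcal D\sigma$ with $\mathcal D(\sigma\tau)\subseteq(\mathcal D\sigma\to\mathcal D\tau)$; it is *standard* if equality always holds here. An *interpretation* is an assignment of values in a frame to all names under which every term has a value. A *standard model* of a set of formulas is an interpretation into a standard frame with $\mathcal D o=\{0,1\}$ that gives the logical constants their usual meaning and makes all formulas in the set true. *Normalization.* A normalization operator is a type-preserving total function $[\cdot]$ on terms such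 that $[[s]]=[s]$; $[[s]t]=[st]$; $[xs_1\dots s_n]=x[s_1]\dots[s_n]$ if $x$ is a name, $n\ge 0$ and $xs_1\dots s_n$ has a base type; $[s]$ and $s$ have the same value under every interpretation; and every type-preserving partial function $\theta$ from names to terms (a substitution) extends to a type-preserving total function $\hat\theta$ on terms such that $\hat\theta x=\theta x$ if $\theta$ is defined on $x$ and $\hat\theta x=x$ otherwise, $\hat\theta(st)=(\hat\theta s)(\hat\theta t)$, $[(\hat\theta(\lambda x.s))t]=[\widehat{\theta^x_t}s]$ (where $\theta^x_t$ agrees with $\theta$ except that it maps $x$ to $t$), and $[\hat\emptyset s]=[s]$. A term $s$ is *normal* if $[s]=s$. *EFO.* A term is EFO if the only logical constants in it are $\neg$, $\to$, $=_\alpha$, $\forall_\alpha$ with $\alpha$ a sort. An *EFO branch* is a set of normal formulas each of which is EFO or of the form $s\neq_\sigma t$ with $s,t$ EFO and $\sigma$ any type. A term $u:\alpha$ is *discriminating* in a branch $A$ if $u\ne_\alpha t$ or $t\neq_\alpha u$ is in $A$ for some $t$. *Calculus.* The refutable branches form the least set such that $A$ is refutable whenever some rule has its premises in $A$ and the branches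 obtained by adding to $A$ each of its alternatives (separated by $\mid$) are all refutable. Below, $x$ is a variable and $\alpha$ a sort; "fresh" means not free in any formula of $A$. The rules are: 1. $\neg\neg s\ /\ s$. 2. $s\ne_o t\ /\ s,\neg t\mid\neg s,t$. 3. $s\to t\ /\ \neg s\mid t$. 4. $\neg(s\to t)\ /\ s,\neg t$. 5. $xs_1\dots s_n,\ \neg xt_1\dots t_n\ /\ s_1\ne t_1\mid\dots\mid s_n\neq t_n$ ($n\ge0$). 6. $xs_1\dots s_n\ne_\alpha xt_1\dots t_n\ /\ s_1\ne t_1\mid\dots\mid s_n\neq t_n$ ($n\ge 0$). 7. $s\ne_{\sigma\tau}t\ /\ [sx]\ne[tx]$ with $x:\sigma$ fresh, applicable only if $([sy]\ne[ty])\in A$ for no variable $y$. 8. $s=_\alpha t,\ u\ne_\alpha v\ /\ s\ne u,\,t\ne u\mid s\ne v,\,t\neq v$. 9. $\neg\forall_\alpha s\ /\ \neg[sx]$ with $x:\alpha$ fresh, applicable only if $\neg[sy]\in A$ for no variable $y:\alpha$. 10. $\forall_\alpha s\ /\ [su]$ with $u:\alpha$ normal and EFO, subject to this restriction: if some term of type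 $\alpha$ is discriminating in $A$, then $u$ must be discriminating in $A$; otherwise the rule applies only if $[sv]\in A$ for no normal $v:\alpha$, and then $u$ must be a variable, one that occurs free in $A$ if some variable of type $\alpha$ does. -/

import Mathlib

namespace STT

/-- Simple types over the base type `o` of truth values and a set `S` of further base types,
the sorts. -/
inductive Ty (S : Type) : Type
  | o : Ty S
  | sort : S → Ty S
  | arr : Ty S → Ty S → Ty S

variable {S : Type}

def Ty.IsBase : Ty S → Prop
  | .o => True
  | .sort _ => True
  | .arr _ _ => False

/-- Names, indexed by their type: countably infinitely many variables of every type, and the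
logical constants `¬`, `→`, `=_σ` (every type `σ`) and `∀_α` (every sort `α`). -/
inductive Name (S : Type) : Ty S → Type
  | var (σ : Ty S) (n : ℕ) : Name S σ
  | neg : Name S (.arr .o .o)
  | imp : Name S (.arr .o (.arr .o .o))
  | eq (σ : Ty S) : Name S (.arr σ (.arr σ .o))
  | all (α : S) : Name S (.arr (.arr (.sort α) .o) .o)

/-- A name together with its type. -/
abbrev AnyName (S : Type) : Type := Σ σ : Ty S, Name S σ

/-- Terms, indexed by their type. As names include the logical constants, any name can be bound;
terms are not identified up to renaming of bound names. -/
inductive Term (S : Type) : Ty S → Type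
  | name {σ : Ty S} (x : Name S σ) : Term S σ
  | app {σ τ : Ty S} (s : Term S (.arr σ τ)) (t : Term S σ) : Term S τ
  | lam {σ τ : Ty S} (x : Name S σ) (t : Term S τ) : Term S (.arr σ τ)

namespace Term

def var (σ : Ty S) (n : ℕ) : Term S σ := .name (.var σ n)

def neg (s : Term S .o) : Term S .o := .app (.name .neg) s

def imp (s t : Term S .o) : Term S .o := .app (.app (.name .imp) s) t

def eq {σ : Ty S} (s t : Term S σ) : Term S .o := .app (.app (.name (.eq σ)) s) t

/-- The disequation `s ≠_σ t`, that is, `¬ (s =_σ t)`. -/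
def neq {σ : Ty S} (s t : Term S σ) : Term S .o := neg (eq s t)

def all {α : S} (s : Term S (.arr (.sort α) .o)) : Term S .o := .app (.name (.all α)) s

/-- The name `x` occurs free in a term. -/
def FreeIn (x : AnyName S) : {τ : Ty S} → Term S τ → Prop
  | τ, .name y => x = ⟨τ, y⟩
  | _, .app s t => FreeIn x s ∨ FreeIn x t
  | _, .lam (σ := σ) y t => x ≠ ⟨σ, y⟩ ∧ FreeIn x t

end Term

/-- Lists `s₁, …, sₙ` of arguments that take a term of type `σ` to a term of type `τ`. -/
inductive Spine (S : Type) : Ty S → Ty S → Type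
  | nil {σ : Ty S} : Spine S σ σ
  | cons {σ τ ρ : Ty S} (s : Term S σ) (ss : Spine S τ ρ) : Spine S (.arr σ τ) ρ

/-- The term `h s₁ … sₙ`. -/
def Term.apps : {σ τ : Ty S} → Term S σ → Spine S σ τ → Term S τ
  | _, _, h, .nil => h
  | _, _, h, .cons s ss => Term.apps (.app h s) ss

/-- The disequations `s₁ ≠ t₁, …, sₙ ≠ tₙ` between corresponding arguments. If `τ` is a base type
(the only case that is used), two spines from `σ` to `τ` have the same length. -/
def Spine.neqs : {σ τ : Ty S} → Spine S σ τ → Spine S σ τ → Set (Term S .o)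
  | _, _, .cons s ss, .cons t ts => insert (Term.neq s t) (Spine.neqs ss ts)
  | _, _, _, _ => ∅

/-! ### Frames, assignments, interpretations -/

/-- A frame: a nonempty domain for every type, where the elements of the domain of a function type
are functions between the respective domains (`app f` is the function that `f` is). -/
structure Frame (S : Type) where
  dom : Ty S → Type
  nonempty : ∀ σ, Nonempty (dom σ)
  app : ∀ {σ τ : Ty S}, dom (.arr σ τ) → dom σ → dom τ
  ext : ∀ {σ τ : Ty S} (f g : dom (.arr σ τ)), app f = app g → f = g

/-- A standard frame contains all functions. -/
def Frame.IsStandard (F : Frame S) : Prop :=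
  ∀ (σ τ : Ty S) (f : F.dom σ → F.dom τ), ∃ g : F.dom (.arr σ τ), F.app g = f

abbrev Assignment (F : Frame S) : Type := (x : AnyName S) → F.dom x.1

open Classical in
/-- The assignment that agrees with `I` except that it maps `x` to `a`. -/
noncomputable def Assignment.upd {F : Frame S} (I : Assignment F) {σ : Ty S} (x : Name S σ)
    (a : F.dom σ) : Assignment F :=
  Function.update I ⟨σ, x⟩ a

/-- The graph of the partial evaluation function: `s` evaluates to `a` under `I`. -/
def Evaluates (F : Frame S) : {σ : Ty S} → Term S σ → Assignment F → F.dom σ → Prop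
  | σ, .name x, I, a => a = I ⟨σ, x⟩
  | _, .app (σ := σ) (τ := τ) s t, I, b =>
      ∃ (f : F.dom (.arr σ τ)) (a : F.dom σ),
        Evaluates F s I f ∧ Evaluates F t I a ∧ b = F.app f a
  | _, .lam (σ := σ) x t, I, f =>
      ∀ a : F.dom σ, Evaluates F t (I.upd x a) (F.app f a)

/-- An interpretation is an assignment whose evaluation function is defined on all terms. -/
def IsInterpretation (F : Frame S) (I : Assignment F) : Prop :=
  ∀ (σ : Ty S) (s : Term S σ), ∃ a : F.dom σ, Evaluates F s I a

/-- `I` is logical, where `tv` identifies the domain of `o` with the two truth values. -/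
structure IsLogical (F : Frame S) (tv : F.dom .o ≃ Bool) (I : Assignment F) : Prop where
  neg : ∀ a, tv (F.app (I ⟨_, .neg⟩) a) = true ↔ ¬ tv a = true
  imp : ∀ a b, tv (F.app (F.app (I ⟨_, .imp⟩) a) b) = true ↔ (tv a = true → tv b = true)
  eq : ∀ (σ : Ty S) (a b : F.dom σ), tv (F.app (F.app (I ⟨_, .eq σ⟩) a) b) = true ↔ a = b
  all : ∀ (α : S) (f : F.dom (.arr (.sort α) .o)),
    tv (F.app (I ⟨_, .all α⟩) f) = true ↔ ∀ a, tv (F.app f a) = true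

/-- A model of `A` is a logical interpretation under which all formulas in `A` are true. -/
def IsModel (F : Frame S) (I : Assignment F) (A : Set (Term S .o)) : Prop :=
  IsInterpretation F I ∧ ∃ tv : F.dom .o ≃ Bool, IsLogical F tv I ∧
    ∀ s ∈ A, ∃ a, Evaluates F s I a ∧ tv a = true

def HasStandardModel (A : Set (Term S .o)) : Prop :=
  ∃ (F : Frame S) (I : Assignment F), F.IsStandard ∧ IsModel F I A

/-! ### Normalization operators -/

/-- Type-preserving total functions from terms to terms. -/
abbrev TermMap (S : Type) : Type := ∀ ⦃σ : Ty S⦄, Term S σ → Term S σ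

/-- Substitutions: type-preserving partial functions from names to terms. -/
abbrev Subst (S : Type) : Type := (x : AnyName S) → Option (Term S x.1)

open Classical in
noncomputable def Subst.upd (θ : Subst S) {σ : Ty S} (x : Name S σ) (t : Term S σ) : Subst S :=
  Function.update θ ⟨σ, x⟩ (some t)

def Spine.map (φ : TermMap S) : {σ τ : Ty S} → Spine S σ τ → Spine S σ τ
  | _, _, .nil => .nil
  | _, _, .cons s ss => .cons (φ s) (Spine.map φ ss)

/-- `hat` extends every substitution to all terms, in a way that fits with `nf`. -/
structure IsSubstExtension (nf : TermMap S) (hat : Subst S → TermMap S) : Prop where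
  name : ∀ (θ : Subst S) (σ : Ty S) (x : Name S σ),
    hat θ (.name x) = (θ ⟨σ, x⟩).getD (.name x)
  app : ∀ (θ : Subst S) (σ τ : Ty S) (s : Term S (.arr σ τ)) (t : Term S σ),
    hat θ (.app s t) = .app (hat θ s) (hat θ t)
  lam : ∀ (θ : Subst S) (σ τ : Ty S) (x : Name S σ) (s : Term S τ) (t : Term S σ),
    nf (.app (hat θ (.lam x s)) t) = nf (hat (θ.upd x t) s)
  empty : ∀ (σ : Ty S) (s : Term S σ), nf (hat (fun _ => none) s) = nf s

/-- The properties that are required of a normalization operator `nf`. Reduction to `β`-normal form,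
with canonically chosen bound variables, is one example. -/
structure IsNormalization (nf : TermMap S) : Prop where
  idem : ∀ (σ : Ty S) (s : Term S σ), nf (nf s) = nf s
  app : ∀ (σ τ : Ty S) (s : Term S (.arr σ τ)) (t : Term S σ),
    nf (.app (nf s) t) = nf (.app s t)
  apps : ∀ (σ τ : Ty S) (x : Name S σ) (ss : Spine S σ τ), τ.IsBase →
    nf ((Term.name x).apps ss) = (Term.name x).apps (ss.map nf)
  sound : ∀ (F : Frame S) (I : Assignment F), IsInterpretation F I →
    ∀ (σ : Ty S) (s : Term S σ) (a : F.dom σ), Evaluates F (nf s) I a ↔ Evaluates F s I a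
  subst : ∃ hat : Subst S → TermMap S, IsSubstExtension nf hat

/-! ### The EFO fragment -/

/-- Variables and the constants `¬`, `→`, `=_α`, `∀_α` (for sorts `α`). -/
def Name.IsEFO : {σ : Ty S} → Name S σ → Prop
  | _, .var _ _ => True
  | _, .neg => True
  | _, .imp => True
  | _, .eq (.sort _) => True
  | _, .eq _ => False
  | _, .all _ => True

/-- A term is EFO if the only logical constants in it are `¬`, `→`, `=_α`, `∀_α`. -/
def Term.IsEFO : {σ : Ty S} → Term S σ → Prop
  | _, .name x => x.IsEFO
  | _, .app s t => s.IsEFO ∧ t.IsEFO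
  | _, .lam x t => x.IsEFO ∧ t.IsEFO

def IsQuasiEFO (s : Term S .o) : Prop :=
  s.IsEFO ∨ ∃ (σ : Ty S) (t u : Term S σ), t.IsEFO ∧ u.IsEFO ∧ s = Term.neq t u

/-- An EFO branch: a set of normal, quasi-EFO formulas. -/
def IsEFOBranch (nf : TermMap S) (A : Set (Term S .o)) : Prop :=
  ∀ s ∈ A, nf s = s ∧ IsQuasiEFO s

/-! ### The tableau calculus -/

/-- `u` is `α`-discriminating in `A`. -/
def Discriminating (A : Set (Term S .o)) {α : S} (u : Term S (.sort α)) : Prop :=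
  ∃ t : Term S (.sort α), Term.neq u t ∈ A ∨ Term.neq t u ∈ A

/-- The variable `n` of type `σ` occurs free in the branch `A`. -/
def VarFreeIn (A : Set (Term S .o)) (σ : Ty S) (n : ℕ) : Prop :=
  ∃ s ∈ A, s.FreeIn ⟨σ, .var σ n⟩

/-- The instantiations of `∀_α s` that are admitted on the branch `A`. If there are
`α`-discriminating terms in `A`, only these are admitted. Otherwise only a variable is admitted,
and only as long as `A` has no instance of `∀_α s` yet; the variable must be one that occurs
free in `A` if there is one of sort `α`. -/
def AdmitsInstance (nf : TermMap S) (A : Set (Term S .o)) {α : S}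
    (s : Term S (.arr (.sort α) .o)) (u : Term S (.sort α)) : Prop :=
  Discriminating A u ∨
    ((∀ v : Term S (.sort α), ¬ Discriminating A v) ∧
      (∀ v : Term S (.sort α), nf v = v → nf (.app s v) ∉ A) ∧
      ∃ n : ℕ, u = Term.var (.sort α) n ∧
        ((∃ m, VarFreeIn A (.sort α) m) → VarFreeIn A (.sort α) n))

/-- Refutable branches: the least set of branches that contains `A` whenever it contains
`A₁, …, Aₙ` for some instance `A / A₁ | … | Aₙ` of a rule. -/
inductive Refutable (nf : TermMap S) : Set (Term S .o) → Prop
  | dneg (A : Set (Term S .o)) (s : Term S .o) :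
      s.neg.neg ∈ A → Refutable nf (A ∪ {s}) → Refutable nf A
  | boolExt (A : Set (Term S .o)) (s t : Term S .o) :
      Term.neq s t ∈ A → Refutable nf (A ∪ {s, t.neg}) → Refutable nf (A ∪ {s.neg, t}) →
      Refutable nf A
  | imp (A : Set (Term S .o)) (s t : Term S .o) :
      Term.imp s t ∈ A → Refutable nf (A ∪ {s.neg}) → Refutable nf (A ∪ {t}) →
      Refutable nf A
  | negImp (A : Set (Term S .o)) (s t : Term S .o) :
      (Term.imp s t).neg ∈ A → Refutable nf (A ∪ {s, t.neg}) → Refutable nf A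
  | mate (A : Set (Term S .o)) (σ : Ty S) (n : ℕ) (ss ts : Spine S σ .o) :
      (Term.var σ n).apps ss ∈ A → ((Term.var σ n).apps ts).neg ∈ A →
      (∀ d ∈ ss.neqs ts, Refutable nf (A ∪ {d})) → Refutable nf A
  | decompose (A : Set (Term S .o)) (α : S) (σ : Ty S) (n : ℕ) (ss ts : Spine S σ (.sort α)) :
      Term.neq ((Term.var σ n).apps ss) ((Term.var σ n).apps ts) ∈ A →
      (∀ d ∈ ss.neqs ts, Refutable nf (A ∪ {d})) → Refutable nf A
  | funExt (A : Set (Term S .o)) (σ τ : Ty S) (s t : Term S (.arr σ τ)) (n : ℕ) :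
      Term.neq s t ∈ A → ¬ VarFreeIn A σ n →
      (∀ m, Term.neq (nf (.app s (Term.var σ m))) (nf (.app t (Term.var σ m))) ∉ A) →
      Refutable nf (A ∪ {Term.neq (nf (.app s (Term.var σ n))) (nf (.app t (Term.var σ n)))}) →
      Refutable nf A
  | confront (A : Set (Term S .o)) (α : S) (s t u v : Term S (.sort α)) :
      Term.eq s t ∈ A → Term.neq u v ∈ A →
      Refutable nf (A ∪ {Term.neq s u, Term.neq t u}) →
      Refutable nf (A ∪ {Term.neq s v, Term.neq t v}) → Refutable nf A
  | all (A : Set (Term S .o)) (α : S) (s : Term S (.arr (.sort α) .o)) (u : Term S (.sort α)) :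
      Term.all s ∈ A → u.IsEFO → nf u = u → AdmitsInstance nf A s u →
      Refutable nf (A ∪ {nf (.app s u)}) → Refutable nf A
  | negAll (A : Set (Term S .o)) (α : S) (s : Term S (.arr (.sort α) .o)) (n : ℕ) :
      (Term.all s).neg ∈ A → ¬ VarFreeIn A (.sort α) n →
      (∀ m, (nf (.app s (Term.var (.sort α) m))).neg ∉ A) →
      Refutable nf (A ∪ {(nf (.app s (Term.var (.sort α) n))).neg}) → Refutable nf A

end STT

namespace STT

variable {S : Type}

/-! ### Spines and heads -/

namespace Spine

/-! A finite branch that is not refutable grows in finite irrefutable stages into a branch `E` on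
which every rule has been obeyed (`Consistent.exists_evident`). If all alternatives of an applicable
rule were refutable, so would be the branch, hence one alternative can always be added; finiteness
of the stages supplies fresh variables. A standard model is then read off `E`.

The individuals of a sort are the discriminants, that is, the maximal sets of discriminating terms
no two of which are separated by a disequation in `E`. Function domains are full, so the frame is
standard by construction. Since `E` need not decide every formula, a term does not determine a
value; the logical relation `Possible` collects the values that `E` permits. Variables receive
possible values, the standard meaning of each EFO constant is a possible value of it
(`Evident.possible_name`), and induction on terms then makes the value of every EFO term possible
(`possible_hat`). So the EFO formulas in `E` are true. Disequations at arbitrary types are true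
because terms with a common possible value are not separated. This last point rests on a second
logical relation, `Compat`: a set of terms has a common possible value if its members are pairwise
compatible, terms with a common possible value are compatible (`Evident.possible_aux`), and
compatible terms are not separated (`Evident.compat_aux`).

Instantiating quantifiers with discriminating terms alone suffices because, once there are such
terms, every discriminant contains one. This needs that `u ≠ u` is never in `E` at a sort; no rule
closes such a branch at once in general, and the proof (`Evident.neq_self_not_mem`) is a separate
logical-relations argument with `Compat`. -/

def snoc : {σ τ ρ : Ty S} → Spine S σ (.arr τ ρ) → Term S τ → Spine S σ ρ
  | _, _, _, .nil, t => .cons t .nil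
  | _, _, _, .cons s ss, t => .cons s (snoc ss t)

/-- `Forall₂` for spines: corresponding arguments are related by `P`. -/
inductive Rel (P : ∀ ⦃σ : Ty S⦄, Term S σ → Term S σ → Prop) :
    {σ τ : Ty S} → Spine S σ τ → Spine S σ τ → Prop
  | nil {σ : Ty S} : Rel P (.nil : Spine S σ σ) .nil
  | cons {σ τ ρ : Ty S} {s t : Term S σ} {ss ts : Spine S τ ρ} :
      P s t → Rel P ss ts → Rel P (.cons s ss) (.cons t ts)

/-- The target type of a spine is an index, so induction needs it to be a variable; the equation `e`
recovers the arrow afterwards. -/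
theorem Rel.snoc {P : ∀ ⦃σ : Ty S⦄, Term S σ → Term S σ → Prop} {σ τ : Ty S}
    {ss ts : Spine S σ τ} (h : Rel P ss ts) :
    ∀ {μ ν : Ty S} (e : τ = .arr μ ν) {u v : Term S μ}, P u v →
      Rel P ((e ▸ ss : Spine S σ (.arr μ ν)).snoc u) ((e ▸ ts : Spine S σ (.arr μ ν)).snoc v) := by
  induction h with
  | nil => rintro μ ν rfl u v h; exact .cons h .nil
  | cons h _ ih => rintro μ ν rfl u v h'; exact .cons h (ih rfl h')

theorem Rel.symm {P : ∀ ⦃σ : Ty S⦄, Term S σ → Term S σ → Prop}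
    (hP : ∀ ⦃σ : Ty S⦄ (s t : Term S σ), P s t → P t s) {σ τ : Ty S}
    {ss ts : Spine S σ τ} (h : Rel P ss ts) : Rel P ts ss := by
  induction h with
  | nil => exact .nil
  | cons h _ ih => exact .cons (hP _ _ h) ih

theorem Rel.of_mem_neqs {P : ∀ ⦃σ : Ty S⦄, Term S σ → Term S σ → Prop} (φ : TermMap S)
    {σ τ : Ty S} {ss ts : Spine S σ τ} (h : Rel P ss ts) {d : Term S .o}
    (hd : d ∈ (ss.map φ).neqs (ts.map φ)) :
    ∃ (ρ : Ty S) (u v : Term S ρ), P u v ∧ d = Term.neq (φ u) (φ v) := by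
  induction h with
  | nil => exact hd.elim
  | cons h _ ih =>
    rcases hd with rfl | hd
    · exact ⟨_, _, _, h, rfl⟩
    · exact ih hd

def IsEFO : {σ τ : Ty S} → Spine S σ τ → Prop
  | _, _, .nil => True
  | _, _, .cons s ss => s.IsEFO ∧ IsEFO ss

theorem exists_of_mem_neqs (φ : TermMap S) {σ τ : Ty S} {ss ts : Spine S σ τ}
    (hs : ss.IsEFO) (ht : ts.IsEFO) (hs' : ss.map φ = ss) (ht' : ts.map φ = ts)
    {d : Term S .o} (hd : d ∈ ss.neqs ts) :
    ∃ (ρ : Ty S) (u v : Term S ρ), (φ u = u ∧ u.IsEFO) ∧ (φ v = v ∧ v.IsEFO) ∧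
      d = Term.neq u v := by
  induction ss with
  | nil => cases ts <;> exact hd.elim
  | cons s ss ih =>
    cases ts with
    | nil => exact hd.elim
    | cons t ts =>
      simp only [map, cons.injEq] at hs' ht'
      rcases hd with rfl | hd
      · exact ⟨_, _, _, ⟨hs'.1, hs.1⟩, ⟨ht'.1, ht.1⟩, rfl⟩
      · exact ih hs.2 ht.2 hs'.2 ht'.2 hd

end Spine

/-! ### Injectivity and disjointness of the shapes of formulas -/

namespace Term

theorem apps_snoc {σ τ : Ty S} (h : Term S σ) (ss : Spine S σ τ) :
    ∀ {μ ν : Ty S} (e : τ = .arr μ ν) (u : Term S μ),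
      h.apps ((e ▸ ss : Spine S σ (.arr μ ν)).snoc u) = .app (e ▸ h.apps ss) u := by
  induction ss with
  | nil => rintro μ ν rfl u; rfl
  | cons s ss ih => rintro μ ν rfl u; exact ih _ rfl u

/-- The head and the arguments of a term applied to a spine, if the head is a name. -/
def unapps {τ : Ty S} : {σ : Ty S} → Term S σ → Spine S σ τ → Option (Σ ρ, Name S ρ × Spine S ρ τ)
  | _, .name x, ss => some ⟨_, x, ss⟩
  | _, .app s t, ss => unapps s (.cons t ss)
  | _, .lam _ _, _ => none

theorem unapps_apps {σ τ : Ty S} (ss : Spine S σ τ) (h : Term S σ) :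
    unapps (h.apps ss) .nil = unapps h ss := by
  -- The accumulator is generalized, but instead of defining concatenation of spines only the case
  -- of an empty accumulator is tracked.
  suffices ∀ {σ τ : Ty S} (ss : Spine S σ τ) (h : Term S σ) {ρ : Ty S} (ts : Spine S τ ρ),
      ∃ us : Spine S σ ρ, unapps (h.apps ss) ts = unapps h us ∧
        ∀ e : τ = ρ, HEq ts (Spine.nil : Spine S τ τ) → us = e ▸ ss by
    obtain ⟨us, h1, h2⟩ := this ss h .nil
    rw [h1, h2 rfl HEq.rfl]
  intro σ τ ss
  induction ss with
  | nil =>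
    intro h ρ ts
    refine ⟨ts, rfl, ?_⟩
    rintro rfl h
    exact eq_of_heq h
  | cons s ss ih =>
    intro h ρ ts
    obtain ⟨us, h1, h2⟩ := ih (.app h s) ts
    refine ⟨.cons s us, h1, ?_⟩
    rintro rfl h
    rw [h2 rfl h]

theorem name_apps_inj {σ σ' τ : Ty S} {x : Name S σ} {y : Name S σ'} {ss : Spine S σ τ}
    {ts : Spine S σ' τ} (h : (name x).apps ss = (name y).apps ts) :
    (⟨σ, x, ss⟩ : Σ ρ, Name S ρ × Spine S ρ τ) = ⟨σ', y, ts⟩ := by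
  have := congrArg (fun s => unapps s .nil) h
  simpa only [unapps_apps, unapps, Option.some.injEq] using this

theorem isEFO_apps {σ τ : Ty S} (ss : Spine S σ τ) :
    ∀ h : Term S σ, (h.apps ss).IsEFO ↔ h.IsEFO ∧ ss.IsEFO := by
  induction ss with
  | nil => intro h; simp [apps, Spine.IsEFO]
  | cons s ss ih => intro h; simp only [apps, ih, IsEFO, Spine.IsEFO, and_assoc]

theorem isEFO_var (σ : Ty S) (n : ℕ) : (var σ n).IsEFO := trivial

theorem finite_freeIn {τ : Ty S} (s : Term S τ) : {x : AnyName S | s.FreeIn x}.Finite := by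
  induction s with
  | name y => exact Set.finite_singleton _
  | app s t hs ht => exact hs.union ht
  | lam y t ht => exact ht.subset fun _ h => h.2

@[simp] theorem neg_inj {s t : Term S .o} : neg s = neg t ↔ s = t := by
  simp [neg]

@[simp] theorem imp_inj {s t s' t' : Term S .o} : imp s t = imp s' t' ↔ s = s' ∧ t = t' := by
  simp [imp]

theorem eq_inj {σ σ' : Ty S} {s t : Term S σ} {s' t' : Term S σ'} (h : eq s t = eq s' t') :
    ∃ e : σ = σ', e ▸ s = s' ∧ e ▸ t = t' := by
  simp only [eq, app.injEq] at h
  obtain ⟨rfl, h, h'⟩ := h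
  simp at h
  exact ⟨rfl, h, eq_of_heq h'⟩

theorem all_inj {α β : S} {s : Term S (.arr (.sort α) .o)} {t : Term S (.arr (.sort β) .o)}
    (h : all s = all t) : ∃ e : α = β, e ▸ s = t := by
  simp only [all, app.injEq, Ty.arr.injEq, Ty.sort.injEq] at h
  obtain ⟨⟨rfl, -⟩, -, h⟩ := h
  exact ⟨rfl, eq_of_heq h⟩

theorem neg_ne_eq {σ : Ty S} {s : Term S .o} {t u : Term S σ} : neg s ≠ eq t u := by
  intro h
  simp only [neg, eq, app.injEq] at h
  obtain ⟨rfl, h, -⟩ := h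
  cases h

theorem imp_ne_eq {σ : Ty S} {s s' : Term S .o} {t u : Term S σ} : imp s s' ≠ eq t u := by
  intro h
  simp only [imp, eq, app.injEq] at h
  obtain ⟨rfl, ⟨-, h, -⟩, -⟩ := h

theorem all_ne_eq {α : S} {σ : Ty S} {s : Term S (.arr (.sort α) .o)} {t u : Term S σ} :
    all s ≠ eq t u := by
  intro h
  simp only [all, eq, app.injEq] at h
  obtain ⟨rfl, h, -⟩ := h
  cases h

theorem imp_ne_neg {s t u : Term S .o} : imp s t ≠ neg u := by
  simp [imp, neg]

theorem eq_ne_neg {σ : Ty S} {s t : Term S σ} {u : Term S .o} : eq s t ≠ neg u :=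
  neg_ne_eq.symm

theorem all_ne_neg {α : S} {s : Term S (.arr (.sort α) .o)} {u : Term S .o} : all s ≠ neg u := by
  intro h
  simp only [all, neg, app.injEq] at h
  obtain ⟨h, -⟩ := h
  cases h

theorem var_apps_ne_neg {σ : Ty S} {n : ℕ} {ss : Spine S σ .o} {u : Term S .o} :
    (var σ n).apps ss ≠ neg u := by
  intro h
  -- A negation is itself a name applied to a spine, so the two heads would have to agree.
  cases name_apps_inj (y := .neg) (ts := .cons u .nil) h

theorem var_apps_ne_eq {σ τ : Ty S} {n : ℕ} {ss : Spine S σ .o} {t u : Term S τ} :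
    (var σ n).apps ss ≠ eq t u := by
  intro h
  cases name_apps_inj (y := .eq τ) (ts := .cons t (.cons u .nil)) h

end Term

/-! ### Normal terms -/

/-- Normal EFO terms. -/
def NormalEFO (nf : TermMap S) {σ : Ty S} (s : Term S σ) : Prop := nf s = s ∧ s.IsEFO

/-- The formulas that may occur on an EFO branch. -/
def Admissible (nf : TermMap S) (s : Term S .o) : Prop := nf s = s ∧ IsQuasiEFO s

theorem NormalEFO.admissible {nf : TermMap S} {s : Term S .o} (h : NormalEFO nf s) :
    Admissible nf s := ⟨h.1, .inl h.2⟩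

theorem normalEFO_of_admissible {nf : TermMap S} {s : Term S .o} (h : Admissible nf s)
    (h' : ∀ (σ : Ty S) (t u : Term S σ), s ≠ t.neq u) : NormalEFO nf s := by
  obtain ⟨h1, h2 | ⟨σ, t, u, -, -, h2⟩⟩ := h
  · exact ⟨h1, h2⟩
  · exact (h' σ t u h2).elim

namespace IsNormalization

variable {nf : TermMap S}

theorem nf_neg (hnf : IsNormalization nf) (s : Term S .o) : nf s.neg = (nf s).neg :=
  hnf.apps _ _ .neg (.cons s .nil) trivial

theorem nf_imp (hnf : IsNormalization nf) (s t : Term S .o) : nf (s.imp t) = (nf s).imp (nf t) :=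
  hnf.apps _ _ .imp (.cons s (.cons t .nil)) trivial

theorem nf_eq (hnf : IsNormalization nf) {σ : Ty S} (s t : Term S σ) : nf (s.eq t) = (nf s).eq (nf t) :=
  hnf.apps _ _ (.eq σ) (.cons s (.cons t .nil)) trivial

theorem nf_all (hnf : IsNormalization nf) {α : S} (s : Term S (.arr (.sort α) .o)) : nf s.all = (nf s).all :=
  hnf.apps _ _ (.all α) (.cons s .nil) trivial

theorem nf_neq (hnf : IsNormalization nf) {σ : Ty S} (s t : Term S σ) : nf (s.neq t) = (nf s).neq (nf t) := by
  rw [Term.neq, hnf.nf_neg, hnf.nf_eq, Term.neq]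

theorem nf_app_congr (hnf : IsNormalization nf) {σ τ : Ty S} {s t : Term S (.arr σ τ)} (h : nf s = nf t) (u : Term S σ) :
    nf (.app s u) = nf (.app t u) := by
  rw [← hnf.app, h, hnf.app]

theorem normalEFO_neg (hnf : IsNormalization nf) {s : Term S .o} : NormalEFO nf s.neg ↔ NormalEFO nf s := by
  simp [NormalEFO, hnf.nf_neg]
  simp [Term.neg, Term.IsEFO, Name.IsEFO]

theorem normalEFO_imp (hnf : IsNormalization nf) {s t : Term S .o} :
    NormalEFO nf (s.imp t) ↔ NormalEFO nf s ∧ NormalEFO nf t := by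
  simp [NormalEFO, hnf.nf_imp]
  simp [Term.imp, Term.IsEFO, Name.IsEFO]
  tauto

theorem normalEFO_all (hnf : IsNormalization nf) {α : S} {s : Term S (.arr (.sort α) .o)} (h : NormalEFO nf s.all) :
    NormalEFO nf s := by
  obtain ⟨h, h'⟩ := h
  rw [hnf.nf_all] at h
  obtain ⟨_, h⟩ := Term.all_inj h
  exact ⟨h, h'.2⟩

theorem normalEFO_eq (hnf : IsNormalization nf) {σ : Ty S} {s t : Term S σ} (h : NormalEFO nf (s.eq t)) :
    NormalEFO nf s ∧ NormalEFO nf t := by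
  obtain ⟨h, h'⟩ := h
  rw [hnf.nf_eq] at h
  obtain ⟨_, h1, h2⟩ := Term.eq_inj h
  exact ⟨⟨h1, h'.1.2⟩, h2, h'.2⟩

theorem normalEFO_var (hnf : IsNormalization nf) (α : S) (n : ℕ) :
    NormalEFO nf (Term.var (.sort α) n) :=
  ⟨hnf.apps _ _ (.var _ n) .nil trivial, trivial⟩

theorem admissible_neq (hnf : IsNormalization nf) {σ : Ty S} {s t : Term S σ} :
    Admissible nf (s.neq t) ↔ NormalEFO nf s ∧ NormalEFO nf t := by
  constructor
  · rintro ⟨h, h'⟩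
    rw [hnf.nf_neq] at h
    obtain ⟨_, h1, h2⟩ := Term.eq_inj (Term.neg_inj.1 h)
    obtain h' | ⟨ρ, t, u, ht, hu, h'⟩ := h'
    · exact ⟨⟨h1, h'.2.1.2⟩, h2, h'.2.2⟩
    · obtain ⟨rfl, rfl, rfl⟩ := Term.eq_inj (Term.neg_inj.1 h')
      exact ⟨⟨h1, ht⟩, h2, hu⟩
  · rintro ⟨hs, ht⟩
    exact ⟨by rw [hnf.nf_neq, hs.1, ht.1], .inr ⟨σ, s, t, hs.2, ht.2, rfl⟩⟩

theorem spine_of_normalEFO (hnf : IsNormalization nf) {σ τ : Ty S} {x : Name S σ} {ss : Spine S σ τ} (hτ : τ.IsBase)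
    (h : NormalEFO nf ((Term.name x).apps ss)) : ss.IsEFO ∧ ss.map nf = ss := by
  obtain ⟨h1, h2⟩ := h
  rw [hnf.apps _ _ x ss hτ] at h1
  have := Term.name_apps_inj h1
  simp only [Sigma.mk.injEq, heq_eq_eq, Prod.mk.injEq, true_and] at this
  exact ⟨((Term.isEFO_apps _ _).1 h2).2, this⟩

end IsNormalization
/-! ### Saturation of branches that are not refutable -/

/-- Finite EFO branches that are not refutable. -/
structure Consistent (nf : TermMap S) (B : Set (Term S .o)) : Prop where
  finite : B.Finite
  branch : IsEFOBranch nf B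
  irrefutable : ¬ Refutable nf B

theorem Consistent.union {nf : TermMap S} {B N : Set (Term S .o)} (hB : Consistent nf B)
    (hN : N.Finite) (h : ∀ s ∈ N, Admissible nf s) (h' : ¬ Refutable nf (B ∪ N)) :
    Consistent nf (B ∪ N) where
  finite := hB.finite.union hN
  branch := by
    rintro s (hs | hs)
    · exact hB.branch s hs
    · exact h s hs
  irrefutable := h'

theorem Consistent.union_singleton {nf : TermMap S} {B : Set (Term S .o)} {s : Term S .o}
    (hB : Consistent nf B) (h : Admissible nf s) (h' : ¬ Refutable nf (B ∪ {s})) :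
    Consistent nf (B ∪ {s}) :=
  hB.union (Set.finite_singleton s) (by rintro _ rfl; exact h) h'

theorem Consistent.union_pair {nf : TermMap S} {B : Set (Term S .o)} {s t : Term S .o}
    (hB : Consistent nf B) (hs : Admissible nf s) (ht : Admissible nf t)
    (h' : ¬ Refutable nf (B ∪ {s, t})) :
    Consistent nf (B ∪ {s, t}) :=
  hB.union (Set.toFinite _) (by rintro _ (rfl | rfl) <;> assumption) h'

/-- A condition is attainable above `A` if it is preserved by extension and every consistent branch
above `A` has a consistent extension that satisfies it. -/
structure Attainable (nf : TermMap S) (A : Set (Term S .o)) (C : Set (Term S .o) → Prop) :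
    Prop where
  mono : ∀ ⦃B B'⦄, B ⊆ B' → C B → C B'
  extend : ∀ B, A ⊆ B → Consistent nf B → ∃ B', B ⊆ B' ∧ Consistent nf B' ∧ C B'

namespace Attainable

variable {nf : TermMap S} {A : Set (Term S .o)}

theorem trivial : Attainable nf A fun _ => True :=
  ⟨fun _ _ _ h => h, fun B _ h => ⟨B, subset_rfl, h, True.intro⟩⟩

/-- Monotonicity keeps the first condition alive while the second is attained. Hence all conditions
of a finite stage can be met together. -/
theorem and {C D : Set (Term S .o) → Prop} (hC : Attainable nf A C) (hD : Attainable nf A D) :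
    Attainable nf A fun B => C B ∧ D B where
  mono _ _ h h' := ⟨hC.mono h h'.1, hD.mono h h'.2⟩
  extend B hAB hB := by
    obtain ⟨B₁, h₁, hB₁, hC₁⟩ := hC.extend B hAB hB
    obtain ⟨B₂, h₂, hB₂, hD₂⟩ := hD.extend B₁ (hAB.trans h₁) hB₁
    exact ⟨B₂, h₁.trans h₂, hB₂, hC.mono h₂ hC₁, hD₂⟩

theorem forall_finite {ι : Type*} {I : Set ι} (hI : I.Finite) {C : ι → Set (Term S .o) → Prop}
    (hC : ∀ i ∈ I, Attainable nf A (C i)) : Attainable nf A fun B => ∀ i ∈ I, C i B := by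
  induction I, hI using Set.Finite.induction_on with
  | empty => simpa using trivial
  | @insert i I _ _ ih =>
    simp only [Set.forall_mem_insert] at hC ⊢
    exact hC.1.and (ih hC.2)

/-- A condition that is void unless `P` holds has to be attained only if `P` holds. -/
theorem of_imp {P : Prop} {C : Set (Term S .o) → Prop} (h : ¬ P → ∀ B, C B)
    (h' : P → Attainable nf A C) : Attainable nf A C := by
  by_cases hP : P
  · exact h' hP
  · exact ⟨fun _ B _ _ => h hP B, fun B _ hB => ⟨B, subset_rfl, hB, h hP B⟩⟩

theorem congr {C D : Set (Term S .o) → Prop} (h : ∀ B, C B ↔ D B) (hC : Attainable nf A C) :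
    Attainable nf A D := by
  rwa [← show C = D from funext fun B => propext (h B)]

end Attainable

/-- Some variable of type `σ` is not free in a finite branch. -/
theorem exists_fresh {A : Set (Term S .o)} (hA : A.Finite) (σ : Ty S) :
    ∃ n, ¬ VarFreeIn A σ n := by
  have h1 : {x : AnyName S | ∃ s ∈ A, s.FreeIn x}.Finite := by
    have := hA.biUnion (t := fun s => {x : AnyName S | s.FreeIn x})
      fun s _ => Term.finite_freeIn s
    refine this.subset ?_
    rintro x ⟨s, hs, hx⟩
    exact Set.mem_biUnion hs hx
  have h2 : Function.Injective fun n : ℕ => (⟨σ, .var σ n⟩ : AnyName S) := by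
    intro m n h
    simpa using h
  obtain ⟨n, hn⟩ := (h1.preimage h2.injOn).infinite_compl.nonempty
  exact ⟨n, hn⟩

/-- The conditions on `B` that belong to the rules with premises `p` and `q`. -/
structure Sat (nf : TermMap S) (p q : Term S .o) (B : Set (Term S .o)) : Prop where
  dneg : ∀ s : Term S .o, p = s.neg.neg → s ∈ B
  boolExt : ∀ s t : Term S .o, p = s.neq t → (s ∈ B ∧ t.neg ∈ B) ∨ (s.neg ∈ B ∧ t ∈ B)
  imp : ∀ s t : Term S .o, p = s.imp t → s.neg ∈ B ∨ t ∈ B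
  negImp : ∀ s t : Term S .o, p = (s.imp t).neg → s ∈ B ∧ t.neg ∈ B
  mate : ∀ (σ : Ty S) (n : ℕ) (ss ts : Spine S σ .o),
    p = (Term.var σ n).apps ss → q = ((Term.var σ n).apps ts).neg → ∃ d ∈ ss.neqs ts, d ∈ B
  decompose : ∀ (α : S) (σ : Ty S) (n : ℕ) (ss ts : Spine S σ (.sort α)),
    p = ((Term.var σ n).apps ss).neq ((Term.var σ n).apps ts) → ∃ d ∈ ss.neqs ts, d ∈ B
  funExt : ∀ (σ τ : Ty S) (s t : Term S (.arr σ τ)), p = s.neq t →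
    ∃ n, (nf (.app s (.var σ n))).neq (nf (.app t (.var σ n))) ∈ B
  confront : ∀ (α : S) (s t u v : Term S (.sort α)), p = s.eq t → q = u.neq v →
    (s.neq u ∈ B ∧ t.neq u ∈ B) ∨ (s.neq v ∈ B ∧ t.neq v ∈ B)
  allNeq : ∀ (α : S) (s : Term S (.arr (.sort α) .o)) (u v : Term S (.sort α)),
    p = s.all → q = u.neq v → nf (.app s u) ∈ B ∧ nf (.app s v) ∈ B
  all : ∀ (α : S) (s : Term S (.arr (.sort α) .o)), p = s.all →
    (∃ v : Term S (.sort α), Discriminating B v) ∨ ∃ v, nf (.app s v) ∈ B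
  negAll : ∀ (α : S) (s : Term S (.arr (.sort α) .o)), p = s.all.neg →
    ∃ n, (nf (.app s (.var (.sort α) n))).neg ∈ B

/-! ### The condition of each rule is attainable -/

section

variable {nf : TermMap S} {A : Set (Term S .o)} {p q : Term S .o}

/-- The pattern for all rules: by `Attainable.of_imp` the premises may be assumed to have the
required shape, injectivity of that shape leaves a single instance of the condition, and the rule
read contrapositively yields an irrefutable extension. -/
theorem attainable_dneg (hnf : IsNormalization nf) (hp : p ∈ A) :
    Attainable nf A fun B => ∀ s : Term S .o, p = s.neg.neg → s ∈ B := by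
  refine .of_imp (P := ∃ s : Term S .o, p = s.neg.neg) (fun h B s hs => (h ⟨s, hs⟩).elim) ?_
  rintro ⟨s, rfl⟩
  simp only [Term.neg_inj, forall_eq']
  refine ⟨fun B B' h h' => h h', fun B hAB hB => ?_⟩
  have hs : NormalEFO nf s.neg.neg := normalEFO_of_admissible (hB.branch _ (hAB hp))
    fun _ _ _ h => Term.neg_ne_eq (Term.neg_inj.1 h)
  rw [hnf.normalEFO_neg, hnf.normalEFO_neg] at hs
  exact ⟨_, Set.subset_union_left,
    hB.union_singleton hs.admissible fun h => hB.irrefutable (.dneg _ _ (hAB hp) h), by simp⟩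

theorem attainable_boolExt (hnf : IsNormalization nf) (hp : p ∈ A) :
    Attainable nf A fun B => ∀ s t : Term S .o, p = s.neq t →
      (s ∈ B ∧ t.neg ∈ B) ∨ (s.neg ∈ B ∧ t ∈ B) := by
  refine .of_imp (P := ∃ s t : Term S .o, p = s.neq t) (fun h B s t hs => (h ⟨s, t, hs⟩).elim) ?_
  rintro ⟨s, t, rfl⟩
  refine .congr (C := fun B => (s ∈ B ∧ t.neg ∈ B) ∨ (s.neg ∈ B ∧ t ∈ B)) ?_ ?_
  · refine fun B => ⟨fun h s' t' e => ?_, fun h => h _ _ rfl⟩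
    obtain ⟨_, rfl, rfl⟩ := Term.eq_inj (Term.neg_inj.1 e)
    exact h
  refine ⟨fun B B' h h' => h'.imp (.imp (@h _) (@h _)) (.imp (@h _) (@h _)), fun B hAB hB => ?_⟩
  obtain ⟨hs, ht⟩ := hnf.admissible_neq.1 (hB.branch _ (hAB hp))
  -- If one alternative is refutable, the other is not, since otherwise the rule would refute `B`.
  by_cases h : Refutable nf (B ∪ {s, t.neg})
  · exact ⟨_, Set.subset_union_left, hB.union_pair (hnf.normalEFO_neg.2 hs).admissible ht.admissible
      fun h' => hB.irrefutable (.boolExt _ _ _ (hAB hp) h h'), by simp⟩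
  · exact ⟨_, Set.subset_union_left,
      hB.union_pair hs.admissible (hnf.normalEFO_neg.2 ht).admissible h, by simp⟩

theorem attainable_imp (hnf : IsNormalization nf) (hp : p ∈ A) :
    Attainable nf A fun B => ∀ s t : Term S .o, p = s.imp t → s.neg ∈ B ∨ t ∈ B := by
  refine .of_imp (P := ∃ s t : Term S .o, p = s.imp t) (fun h B s t hs => (h ⟨s, t, hs⟩).elim) ?_
  rintro ⟨s, t, rfl⟩
  refine .congr (C := fun B => s.neg ∈ B ∨ t ∈ B) ?_ ?_
  · refine fun B => ⟨fun h s' t' e => ?_, fun h => h _ _ rfl⟩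
    obtain ⟨rfl, rfl⟩ := Term.imp_inj.1 e
    exact h
  refine ⟨fun B B' h h' => h'.imp (@h _) (@h _), fun B hAB hB => ?_⟩
  obtain ⟨hs, ht⟩ := hnf.normalEFO_imp.1 <| normalEFO_of_admissible (hB.branch _ (hAB hp))
    fun _ _ _ h => Term.imp_ne_neg h
  by_cases h : Refutable nf (B ∪ {s.neg})
  · exact ⟨_, Set.subset_union_left, hB.union_singleton ht.admissible
      fun h' => hB.irrefutable (.imp _ _ _ (hAB hp) h h'), by simp⟩
  · exact ⟨_, Set.subset_union_left,
      hB.union_singleton (hnf.normalEFO_neg.2 hs).admissible h, by simp⟩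

theorem attainable_negImp (hnf : IsNormalization nf) (hp : p ∈ A) :
    Attainable nf A fun B => ∀ s t : Term S .o, p = (s.imp t).neg → s ∈ B ∧ t.neg ∈ B := by
  refine .of_imp (P := ∃ s t : Term S .o, p = (s.imp t).neg)
    (fun h B s t hs => (h ⟨s, t, hs⟩).elim) ?_
  rintro ⟨s, t, rfl⟩
  refine .congr (C := fun B => s ∈ B ∧ t.neg ∈ B) ?_ ?_
  · refine fun B => ⟨fun h s' t' e => ?_, fun h => h _ _ rfl⟩
    obtain ⟨rfl, rfl⟩ := Term.imp_inj.1 (Term.neg_inj.1 e)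
    exact h
  refine ⟨fun B B' h h' => h'.imp (@h _) (@h _), fun B hAB hB => ?_⟩
  obtain ⟨hs, ht⟩ := hnf.normalEFO_imp.1 <| hnf.normalEFO_neg.1 <|
    normalEFO_of_admissible (hB.branch _ (hAB hp))
    fun _ _ _ h => Term.imp_ne_eq (Term.neg_inj.1 h)
  exact ⟨_, Set.subset_union_left,
    hB.union_pair hs.admissible (hnf.normalEFO_neg.2 ht).admissible
      fun h => hB.irrefutable (.negImp _ _ _ (hAB hp) h), by simp⟩

/-- For empty spines the hypothesis `h` is contradictory: a rule without alternatives closes the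
branch. Clashes such as `x, ¬x` need no separate treatment. -/
theorem Consistent.exists_neqs (hnf : IsNormalization nf) {B : Set (Term S .o)}
    (hB : Consistent nf B) {σ τ : Ty S} (hτ : τ.IsBase) {x : Name S σ} {ss ts : Spine S σ τ}
    (hs : NormalEFO nf ((Term.name x).apps ss)) (ht : NormalEFO nf ((Term.name x).apps ts))
    (h : ¬ ∀ d ∈ ss.neqs ts, Refutable nf (B ∪ {d})) :
    ∃ B', B ⊆ B' ∧ Consistent nf B' ∧ ∃ d ∈ ss.neqs ts, d ∈ B' := by
  push Not at h
  obtain ⟨d, hd, h⟩ := h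
  obtain ⟨hs, hs'⟩ := hnf.spine_of_normalEFO hτ hs
  obtain ⟨ht, ht'⟩ := hnf.spine_of_normalEFO hτ ht
  refine ⟨_, Set.subset_union_left, hB.union_singleton ?_ h, d, hd, by simp⟩
  obtain ⟨_, u, v, hu, hv, rfl⟩ := Spine.exists_of_mem_neqs nf hs ht hs' ht' hd
  exact hnf.admissible_neq.2 ⟨hu, hv⟩

theorem attainable_mate (hnf : IsNormalization nf) (hp : p ∈ A) (hq : q ∈ A) :
    Attainable nf A fun B => ∀ (σ : Ty S) (n : ℕ) (ss ts : Spine S σ .o),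
      p = (Term.var σ n).apps ss → q = ((Term.var σ n).apps ts).neg →
        ∃ d ∈ ss.neqs ts, d ∈ B := by
  refine .of_imp (P := ∃ (σ : Ty S) (n : ℕ) (ss ts : Spine S σ .o),
      p = (Term.var σ n).apps ss ∧ q = ((Term.var σ n).apps ts).neg)
    (fun h B σ n ss ts hs ht => (h ⟨σ, n, ss, ts, hs, ht⟩).elim) ?_
  rintro ⟨σ, n, ss, ts, rfl, rfl⟩
  refine .congr (C := fun B => ∃ d ∈ ss.neqs ts, d ∈ B) ?_ ?_
  · refine fun B => ⟨fun h σ' n' ss' ts' e e' => ?_, fun h => h _ _ _ _ rfl rfl⟩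
    cases Term.name_apps_inj e
    cases Term.name_apps_inj (Term.neg_inj.1 e')
    exact h
  refine ⟨fun B B' h h' => h'.imp fun d hd => ⟨hd.1, h hd.2⟩, fun B hAB hB => ?_⟩
  refine hB.exists_neqs hnf (τ := .o) True.intro
    (normalEFO_of_admissible (hB.branch _ (hAB hp)) fun _ _ _ h => Term.var_apps_ne_neg h)
    (hnf.normalEFO_neg.1 <| normalEFO_of_admissible (hB.branch _ (hAB hq))
      fun _ _ _ h => Term.var_apps_ne_eq (Term.neg_inj.1 h)) fun h => ?_
  exact hB.irrefutable (.mate _ _ _ _ _ (hAB hp) (hAB hq) h)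

theorem attainable_decompose (hnf : IsNormalization nf) (hp : p ∈ A) :
    Attainable nf A fun B => ∀ (α : S) (σ : Ty S) (n : ℕ) (ss ts : Spine S σ (.sort α)),
      p = ((Term.var σ n).apps ss).neq ((Term.var σ n).apps ts) → ∃ d ∈ ss.neqs ts, d ∈ B := by
  refine .of_imp (P := ∃ (α : S) (σ : Ty S) (n : ℕ) (ss ts : Spine S σ (.sort α)),
      p = ((Term.var σ n).apps ss).neq ((Term.var σ n).apps ts))
    (fun h B α σ n ss ts hs => (h ⟨α, σ, n, ss, ts, hs⟩).elim) ?_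
  rintro ⟨α, σ, n, ss, ts, rfl⟩
  refine .congr (C := fun B => ∃ d ∈ ss.neqs ts, d ∈ B) ?_ ?_
  · refine fun B => ⟨fun h α' σ' n' ss' ts' e => ?_, fun h => h _ _ _ _ _ rfl⟩
    obtain ⟨e, h1, h2⟩ := Term.eq_inj (Term.neg_inj.1 e)
    cases e
    cases Term.name_apps_inj h1
    cases Term.name_apps_inj h2
    exact h
  refine ⟨fun B B' h h' => h'.imp fun d hd => ⟨hd.1, h hd.2⟩, fun B hAB hB => ?_⟩
  obtain ⟨hs, ht⟩ := hnf.admissible_neq.1 (hB.branch _ (hAB hp))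
  refine hB.exists_neqs hnf (τ := .sort α) True.intro hs ht fun h => ?_
  exact hB.irrefutable (.decompose _ _ _ _ _ _ (hAB hp) h)

theorem normalEFO_nf_app (hnf : IsNormalization nf)
    (hEFO : ∀ (σ : Ty S) (s : Term S σ), s.IsEFO → (nf s).IsEFO) {σ τ : Ty S}
    {s : Term S (.arr σ τ)} {t : Term S σ} (hs : s.IsEFO) (ht : t.IsEFO) :
    NormalEFO nf (nf (.app s t)) :=
  ⟨hnf.idem _ _, hEFO _ _ ⟨hs, ht⟩⟩

theorem attainable_funExt (hnf : IsNormalization nf)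
    (hEFO : ∀ (σ : Ty S) (s : Term S σ), s.IsEFO → (nf s).IsEFO) (hp : p ∈ A) :
    Attainable nf A fun B => ∀ (σ τ : Ty S) (s t : Term S (.arr σ τ)), p = s.neq t →
      ∃ n, (nf (.app s (.var σ n))).neq (nf (.app t (.var σ n))) ∈ B := by
  refine .of_imp (P := ∃ (σ τ : Ty S) (s t : Term S (.arr σ τ)), p = s.neq t)
    (fun h B σ τ s t hs => (h ⟨σ, τ, s, t, hs⟩).elim) ?_
  rintro ⟨σ, τ, s, t, rfl⟩
  refine .congr (C := fun B => ∃ n, (nf (.app s (.var σ n))).neq (nf (.app t (.var σ n))) ∈ B) ?_ ?_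
  · refine fun B => ⟨fun h σ' τ' s' t' e => ?_, fun h => h _ _ _ _ rfl⟩
    obtain ⟨e, h1, h2⟩ := Term.eq_inj (Term.neg_inj.1 e)
    cases e
    cases h1
    cases h2
    exact h
  refine ⟨fun B B' h h' => h'.imp fun d hd => h hd, fun B hAB hB => ?_⟩
  -- The rule is barred once a witness is present, but then nothing remains to be done.
  by_cases hex : ∃ n, (nf (.app s (.var σ n))).neq (nf (.app t (.var σ n))) ∈ B
  · exact ⟨B, subset_rfl, hB, hex⟩
  obtain ⟨hs, ht⟩ := hnf.admissible_neq.1 (hB.branch _ (hAB hp))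
  obtain ⟨n, hn⟩ := exists_fresh hB.finite σ
  refine ⟨_, Set.subset_union_left, hB.union_singleton (hnf.admissible_neq.2
    ⟨normalEFO_nf_app hnf hEFO hs.2 (Term.isEFO_var _ _), normalEFO_nf_app hnf hEFO ht.2 (Term.isEFO_var _ _)⟩)
    fun h => hB.irrefutable (.funExt _ _ _ _ _ n (hAB hp) hn (not_exists.1 hex) h), n, by simp⟩

theorem attainable_confront (hnf : IsNormalization nf) (hp : p ∈ A) (hq : q ∈ A) :
    Attainable nf A fun B => ∀ (α : S) (s t u v : Term S (.sort α)), p = s.eq t → q = u.neq v →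
      (s.neq u ∈ B ∧ t.neq u ∈ B) ∨ (s.neq v ∈ B ∧ t.neq v ∈ B) := by
  refine .of_imp (P := ∃ (α : S) (s t u v : Term S (.sort α)), p = s.eq t ∧ q = u.neq v)
    (fun h B α s t u v hs ht => (h ⟨α, s, t, u, v, hs, ht⟩).elim) ?_
  rintro ⟨α, s, t, u, v, rfl, rfl⟩
  refine .congr (C := fun B => (s.neq u ∈ B ∧ t.neq u ∈ B) ∨ (s.neq v ∈ B ∧ t.neq v ∈ B)) ?_ ?_
  · refine fun B => ⟨fun h α' s' t' u' v' e e' => ?_, fun h => h _ _ _ _ _ rfl rfl⟩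
    obtain ⟨e, h1, h2⟩ := Term.eq_inj e
    cases e
    obtain ⟨_, h3, h4⟩ := Term.eq_inj (Term.neg_inj.1 e')
    cases h1
    cases h2
    cases h3
    cases h4
    exact h
  refine ⟨fun B B' h h' => h'.imp (.imp (@h _) (@h _)) (.imp (@h _) (@h _)), fun B hAB hB => ?_⟩
  obtain ⟨hs, ht⟩ := hnf.normalEFO_eq <| normalEFO_of_admissible (hB.branch _ (hAB hp))
    fun _ _ _ h => Term.eq_ne_neg h
  obtain ⟨hu, hv⟩ := hnf.admissible_neq.1 (hB.branch _ (hAB hq))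
  by_cases h : Refutable nf (B ∪ {s.neq u, t.neq u})
  · exact ⟨_, Set.subset_union_left, hB.union_pair (hnf.admissible_neq.2 ⟨hs, hv⟩)
      (hnf.admissible_neq.2 ⟨ht, hv⟩)
      fun h' => hB.irrefutable (.confront _ _ _ _ _ _ (hAB hp) (hAB hq) h h'), by simp⟩
  · exact ⟨_, Set.subset_union_left, hB.union_pair (hnf.admissible_neq.2 ⟨hs, hu⟩)
      (hnf.admissible_neq.2 ⟨ht, hu⟩) h, by simp⟩

theorem Consistent.normalEFO_of_all (hnf : IsNormalization nf) {B : Set (Term S .o)}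
    (hB : Consistent nf B) {α : S} {s : Term S (.arr (.sort α) .o)} (h : s.all ∈ B) :
    NormalEFO nf s :=
  hnf.normalEFO_all <| normalEFO_of_admissible (hB.branch _ h) fun _ _ _ h => Term.all_ne_neg h

theorem attainable_instance (hnf : IsNormalization nf)
    (hEFO : ∀ (σ : Ty S) (s : Term S σ), s.IsEFO → (nf s).IsEFO) {α : S}
    {s : Term S (.arr (.sort α) .o)} {u : Term S (.sort α)} (hs : s.all ∈ A)
    (hu : NormalEFO nf u) (h : Discriminating A u) :
    Attainable nf A fun B => nf (.app s u) ∈ B := by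
  refine ⟨fun B B' h h' => h h', fun B hAB hB => ?_⟩
  have hs' := hB.normalEFO_of_all hnf (hAB hs)
  refine ⟨_, Set.subset_union_left, hB.union_singleton
    (normalEFO_nf_app hnf hEFO hs'.2 hu.2).admissible
    fun h' => hB.irrefutable (.all _ _ _ _ (hAB hs) hu.2 hu.1 (.inl ?_) h'), by simp⟩
  obtain ⟨t, h⟩ := h
  exact ⟨t, h.imp (@hAB _) (@hAB _)⟩

theorem attainable_allNeq (hnf : IsNormalization nf)
    (hEFO : ∀ (σ : Ty S) (s : Term S σ), s.IsEFO → (nf s).IsEFO) (hA : IsEFOBranch nf A)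
    (hp : p ∈ A) (hq : q ∈ A) :
    Attainable nf A fun B => ∀ (α : S) (s : Term S (.arr (.sort α) .o)) (u v : Term S (.sort α)),
      p = s.all → q = u.neq v → nf (.app s u) ∈ B ∧ nf (.app s v) ∈ B := by
  refine .of_imp (P := ∃ (α : S) (s : Term S (.arr (.sort α) .o)) (u v : Term S (.sort α)),
      p = s.all ∧ q = u.neq v) (fun h B α s u v hs hu => (h ⟨α, s, u, v, hs, hu⟩).elim) ?_
  rintro ⟨α, s, u, v, rfl, rfl⟩
  refine .congr (C := fun B => nf (.app s u) ∈ B ∧ nf (.app s v) ∈ B) ?_ ?_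
  · refine fun B => ⟨fun h α' s' u' v' e e' => ?_, fun h => h _ _ _ _ rfl rfl⟩
    obtain ⟨e, h1⟩ := Term.all_inj e
    cases e
    obtain ⟨_, h3, h4⟩ := Term.eq_inj (Term.neg_inj.1 e')
    cases h1
    cases h3
    cases h4
    exact h
  obtain ⟨hu, hv⟩ := hnf.admissible_neq.1 (hA _ hq)
  exact (attainable_instance hnf hEFO hp hu ⟨v, .inl hq⟩).and
    (attainable_instance hnf hEFO hp hv ⟨u, .inr hq⟩)

/-- The disjunction mirrors the restriction on the rule and, unlike the absence of discriminating
terms, survives extension. Once discriminating terms appear, `attainable_allNeq` provides the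
instances. -/
theorem attainable_all (hnf : IsNormalization nf)
    (hEFO : ∀ (σ : Ty S) (s : Term S σ), s.IsEFO → (nf s).IsEFO) (hp : p ∈ A) :
    Attainable nf A fun B => ∀ (α : S) (s : Term S (.arr (.sort α) .o)), p = s.all →
      (∃ v : Term S (.sort α), Discriminating B v) ∨ ∃ v, nf (.app s v) ∈ B := by
  refine .of_imp (P := ∃ (α : S) (s : Term S (.arr (.sort α) .o)), p = s.all)
    (fun h B α s hs => (h ⟨α, s, hs⟩).elim) ?_
  rintro ⟨α, s, rfl⟩
  refine .congr (C := fun B => (∃ v : Term S (.sort α), Discriminating B v) ∨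
    ∃ v, nf (.app s v) ∈ B) ?_ ?_
  · refine fun B => ⟨fun h α' s' e => ?_, fun h => h _ _ rfl⟩
    obtain ⟨e, h1⟩ := Term.all_inj e
    cases e
    cases h1
    exact h
  refine ⟨fun B B' h h' => h'.imp ?_ ?_, fun B hAB hB => ?_⟩
  · rintro ⟨v, t, hv⟩
    exact ⟨v, t, hv.imp (@h _) (@h _)⟩
  · rintro ⟨v, hv⟩
    exact ⟨v, h hv⟩
  by_cases hex : (∃ v : Term S (.sort α), Discriminating B v) ∨ ∃ v, nf (.app s v) ∈ B
  · exact ⟨B, subset_rfl, hB, hex⟩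
  push Not at hex
  have hs := hB.normalEFO_of_all hnf (hAB hp)
  obtain ⟨n, hn⟩ : ∃ n, (∃ m, VarFreeIn B (.sort α) m) → VarFreeIn B (.sort α) n := by
    by_cases h : ∃ m, VarFreeIn B (.sort α) m
    · exact h.imp fun _ h _ => h
    · exact ⟨0, fun h' => (h h').elim⟩
  refine ⟨_, Set.subset_union_left, hB.union_singleton
    (normalEFO_nf_app hnf hEFO hs.2 (Term.isEFO_var _ _)).admissible
    fun h => hB.irrefutable (.all _ _ _ _ (hAB hp) (Term.isEFO_var _ _)
      (hnf.normalEFO_var α n).1 (.inr ⟨hex.1, fun v _ => hex.2 v, n, rfl, hn⟩) h),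
    .inr ⟨Term.var _ n, by simp⟩⟩

theorem attainable_negAll (hnf : IsNormalization nf)
    (hEFO : ∀ (σ : Ty S) (s : Term S σ), s.IsEFO → (nf s).IsEFO) (hp : p ∈ A) :
    Attainable nf A fun B => ∀ (α : S) (s : Term S (.arr (.sort α) .o)), p = s.all.neg →
      ∃ n, (nf (.app s (.var (.sort α) n))).neg ∈ B := by
  refine .of_imp (P := ∃ (α : S) (s : Term S (.arr (.sort α) .o)), p = s.all.neg)
    (fun h B α s hs => (h ⟨α, s, hs⟩).elim) ?_
  rintro ⟨α, s, rfl⟩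
  refine .congr (C := fun B => ∃ n, (nf (.app s (.var (.sort α) n))).neg ∈ B) ?_ ?_
  · refine fun B => ⟨fun h α' s' e => ?_, fun h => h _ _ rfl⟩
    obtain ⟨e, h1⟩ := Term.all_inj (Term.neg_inj.1 e)
    cases e
    cases h1
    exact h
  refine ⟨fun B B' h h' => h'.imp fun d hd => h hd, fun B hAB hB => ?_⟩
  by_cases hex : ∃ n, (nf (.app s (.var (.sort α) n))).neg ∈ B
  · exact ⟨B, subset_rfl, hB, hex⟩
  have hs := hnf.normalEFO_all <| hnf.normalEFO_neg.1 <|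
    normalEFO_of_admissible (hB.branch _ (hAB hp))
      fun _ _ _ h => Term.all_ne_eq (Term.neg_inj.1 h)
  obtain ⟨n, hn⟩ := exists_fresh hB.finite (.sort α)
  refine ⟨_, Set.subset_union_left, hB.union_singleton
    (hnf.normalEFO_neg.2 (normalEFO_nf_app hnf hEFO hs.2 (Term.isEFO_var _ _))).admissible
    fun h => hB.irrefutable (.negAll _ _ _ n (hAB hp) hn (not_exists.1 hex) h), n, by simp⟩

theorem attainable_sat (hnf : IsNormalization nf)
    (hEFO : ∀ (σ : Ty S) (s : Term S σ), s.IsEFO → (nf s).IsEFO) (hA : IsEFOBranch nf A)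
    (hp : p ∈ A) (hq : q ∈ A) : Attainable nf A (Sat nf p q) :=
  .congr
    (fun _ => ⟨fun ⟨h1, h2, h3, h4, h5, h6, h7, h8, h9, h10, h11⟩ =>
      ⟨h1, h2, h3, h4, h5, h6, h7, h8, h9, h10, h11⟩,
      fun ⟨h1, h2, h3, h4, h5, h6, h7, h8, h9, h10, h11⟩ =>
      ⟨h1, h2, h3, h4, h5, h6, h7, h8, h9, h10, h11⟩⟩)
    ((attainable_dneg hnf hp).and <| (attainable_boolExt hnf hp).and <|
      (attainable_imp hnf hp).and <| (attainable_negImp hnf hp).and <|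
      (attainable_mate hnf hp hq).and <| (attainable_decompose hnf hp).and <|
      (attainable_funExt hnf hEFO hp).and <| (attainable_confront hnf hp hq).and <|
      (attainable_allNeq hnf hEFO hA hp hq).and <| (attainable_all hnf hEFO hp).and <|
      attainable_negAll hnf hEFO hp)

/-- Evident branches: the conditions of all rules are satisfied. -/
structure Evident (nf : TermMap S) (E : Set (Term S .o)) : Prop where
  branch : IsEFOBranch nf E
  sat : ∀ p ∈ E, ∀ q ∈ E, Sat nf p q E

theorem Consistent.exists_evident (hnf : IsNormalization nf)
    (hEFO : ∀ (σ : Ty S) (s : Term S σ), s.IsEFO → (nf s).IsEFO) (hA : Consistent nf A) :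
    ∃ E, A ⊆ E ∧ Evident nf E := by
  have step : ∀ B : {B // Consistent nf B}, ∃ B' : {B // Consistent nf B},
      B.1 ⊆ B'.1 ∧ ∀ p ∈ B.1, ∀ q ∈ B.1, Sat nf p q B'.1 := by
    rintro ⟨B, hB⟩
    obtain ⟨B', h, hB', h'⟩ := (Attainable.forall_finite hB.finite fun p hp =>
      Attainable.forall_finite hB.finite fun q hq =>
        attainable_sat hnf hEFO hB.branch hp hq).extend B subset_rfl hB
    exact ⟨⟨B', hB'⟩, h, h'⟩
  choose next hnext hsat using step
  -- Each stage meets all conditions for pairs of premises from the stage before.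
  let b : ℕ → {B // Consistent nf B} := fun n => Nat.rec ⟨A, hA⟩ (fun _ => next) n
  have hb : Monotone fun n => (b n).1 := monotone_nat_of_le_succ fun n => hnext (b n)
  have branch : IsEFOBranch nf (⋃ n, (b n).1) := by
    intro s hs
    obtain ⟨n, hn⟩ := Set.mem_iUnion.1 hs
    exact (b n).2.branch s hn
  refine ⟨⋃ n, (b n).1, Set.subset_iUnion (fun n => (b n).1) 0, branch, fun p hp q hq => ?_⟩
  obtain ⟨m, hm⟩ := Set.mem_iUnion.1 hp
  obtain ⟨n, hn⟩ := Set.mem_iUnion.1 hq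
  -- Both premises are present at stage `max m n`, so their conditions hold one stage later and
  -- persist in the union.
  exact (attainable_sat hnf hEFO branch hp hq).mono
    (Set.subset_iUnion (fun n => (b n).1) (max m n + 1))
    (hsat (b (max m n)) p (hb (le_max_left m n) hm) q (hb (le_max_right m n) hn))

end

/-! ### Compatible terms -/

/-- Compatibility of terms with respect to `E`. If `P` holds, compatible functions have to respect
only those arguments that are compatible with themselves. -/
def Compat (P : Prop) (nf : TermMap S) (E : Set (Term S .o)) :
    (σ : Ty S) → Term S σ → Term S σ → Prop
  | .o, s, t => ¬ (nf s ∈ E ∧ (nf t).neg ∈ E) ∧ ¬ (nf t ∈ E ∧ (nf s).neg ∈ E)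
  | .sort _, s, t => (nf s).neq (nf t) ∉ E ∧ (nf t).neq (nf s) ∉ E
  | .arr σ τ, s, t => ∀ u v : Term S σ, (P → Compat P nf E σ u u) → (P → Compat P nf E σ v v) →
      Compat P nf E σ u v → Compat P nf E τ (.app s u) (.app t v)

section

variable {P : Prop} {nf : TermMap S} {E : Set (Term S .o)}

theorem Compat.symm : ∀ {σ : Ty S} {s t : Term S σ}, Compat P nf E σ s t → Compat P nf E σ t s
  | .o, _, _, h => And.symm h
  | .sort _, _, _, h => And.symm h
  | .arr _ _, _, _, h => fun u v hu hv huv => (h v u hv hu huv.symm).symm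

theorem Compat.congr (hnf : IsNormalization nf) : ∀ {σ : Ty S} {s t s' t' : Term S σ},
    nf s = nf s' → nf t = nf t' → Compat P nf E σ s t → Compat P nf E σ s' t'
  | .o, _, _, _, _, hs, ht, h => by simpa only [Compat, hs, ht] using h
  | .sort _, _, _, _, _, hs, ht, h => by simpa only [Compat, hs, ht] using h
  | .arr _ _, _, _, _, _, hs, ht, h => fun u v hu hv huv =>
    (h u v hu hv huv).congr hnf (hnf.nf_app_congr hs u) (hnf.nf_app_congr ht v)

/-- Neither of the two disequations between the normal forms of `s` and `t` is in `E`. -/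
def Unseparated (nf : TermMap S) (E : Set (Term S .o)) ⦃σ : Ty S⦄ (s t : Term S σ) : Prop :=
  (nf s).neq (nf t) ∉ E ∧ (nf t).neq (nf s) ∉ E

theorem Unseparated.symm ⦃σ : Ty S⦄ (s t : Term S σ) (h : Unseparated nf E s t) :
    Unseparated nf E t s := And.symm h

theorem Unseparated.not_mem {σ τ : Ty S} {ss ts : Spine S σ τ}
    (h : ss.Rel (Unseparated nf E) ts) {d : Term S .o}
    (hd : d ∈ (ss.map nf).neqs (ts.map nf)) : d ∉ E := by
  obtain ⟨_, u, v, h, rfl⟩ := h.of_mem_neqs nf hd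
  exact h.1

theorem Evident.mate_compat (hE : Evident nf E) (hnf : IsNormalization nf) {σ : Ty S} {n : ℕ}
    {ss ts : Spine S σ .o} (h : ss.Rel (Unseparated nf E) ts) :
    ¬ (nf ((Term.var σ n).apps ss) ∈ E ∧ (nf ((Term.var σ n).apps ts)).neg ∈ E) := by
  rintro ⟨h1, h2⟩
  rw [Term.var, hnf.apps _ .o _ _ True.intro] at h1 h2
  obtain ⟨d, hd, hdE⟩ := (hE.sat _ h1 _ h2).mate _ _ _ _ rfl rfl
  exact Unseparated.not_mem h hd hdE

theorem Evident.decompose_compat (hE : Evident nf E) (hnf : IsNormalization nf) {α : S} {σ : Ty S}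
    {n : ℕ} {ss ts : Spine S σ (.sort α)} (h : ss.Rel (Unseparated nf E) ts) :
    (nf ((Term.var σ n).apps ss)).neq (nf ((Term.var σ n).apps ts)) ∉ E := by
  intro h1
  rw [Term.var, hnf.apps _ (.sort α) _ _ True.intro, hnf.apps _ (.sort α) _ _ True.intro] at h1
  obtain ⟨d, hd, hdE⟩ := (hE.sat _ h1 _ h1).decompose _ _ _ _ _ rfl
  exact Unseparated.not_mem h hd hdE

/-- The two halves need each other at arrow types. Two separated functions differ at a variable,
which is compatible with itself by the second half at `σ`. Conversely, compatible arguments are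
unseparated by the first half at `σ`, so they may be appended to the spines. -/
theorem Evident.compat_aux (hE : Evident nf E) (hnf : IsNormalization nf) : ∀ σ : Ty S,
    (∀ s t : Term S σ, Compat P nf E σ s t → (nf s).neq (nf t) ∉ E) ∧
    ∀ (ρ : Ty S) (n : ℕ) (ss ts : Spine S ρ σ), ss.Rel (Unseparated nf E) ts →
      Compat P nf E σ ((Term.var ρ n).apps ss) ((Term.var ρ n).apps ts)
  | .o => by
    refine ⟨fun s t h h' => ?_, fun ρ n ss ts h =>
      ⟨hE.mate_compat hnf h, hE.mate_compat hnf (h.symm Unseparated.symm)⟩⟩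
    obtain ⟨h1, h2⟩ | ⟨h1, h2⟩ := (hE.sat _ h' _ h').boolExt _ _ rfl
    · exact h.1 ⟨h1, h2⟩
    · exact h.2 ⟨h2, h1⟩
  | .sort α => ⟨fun s t h => h.1, fun ρ n ss ts h =>
      ⟨hE.decompose_compat hnf h, hE.decompose_compat hnf (h.symm Unseparated.symm)⟩⟩
  | .arr σ τ => by
    refine ⟨fun s t h h' => ?_, fun ρ n ss ts h u v _ _ huv => ?_⟩
    · obtain ⟨n, hn⟩ := (hE.sat _ h' _ h').funExt _ _ _ _ rfl
      rw [hnf.app, hnf.app] at hn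
      have hx : Compat P nf E σ (.var σ n) (.var σ n) :=
        (hE.compat_aux hnf σ).2 σ n .nil .nil .nil
      exact (hE.compat_aux hnf τ).1 _ _ (h _ _ (fun _ => hx) (fun _ => hx) hx) hn
    · have := (hE.compat_aux hnf τ).2 ρ n _ _ (h.snoc rfl
        (⟨(hE.compat_aux hnf σ).1 u v huv, (hE.compat_aux hnf σ).1 v u huv.symm⟩ :
          Unseparated nf E u v))
      rwa [Term.apps_snoc _ ss rfl, Term.apps_snoc _ ts rfl] at this

theorem Compat.neq_not_mem (hE : Evident nf E) (hnf : IsNormalization nf) {σ : Ty S}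
    {s t : Term S σ} (h : Compat P nf E σ s t) : (nf s).neq (nf t) ∉ E :=
  (hE.compat_aux hnf σ).1 s t h

theorem Evident.compat_var (hE : Evident nf E) (hnf : IsNormalization nf) (P : Prop) (σ : Ty S)
    (n : ℕ) : Compat P nf E σ (.var σ n) (.var σ n) :=
  (hE.compat_aux hnf σ).2 σ n .nil .nil .nil

theorem Evident.compat_name (hE : Evident nf E) (hnf : IsNormalization nf)
    (hP : P → ∀ (α : S) (u : Term S (.sort α)), (nf u).neq (nf u) ∉ E) {σ : Ty S}
    (x : Name S σ) (hx : x.IsEFO) : Compat P nf E σ (.name x) (.name x) := by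
  cases x with
  | var σ n => exact hE.compat_var hnf P σ n
  | neg =>
    suffices ∀ s t : Term S .o, Compat P nf E .o s t → ¬ (nf s.neg ∈ E ∧ (nf t.neg).neg ∈ E) from
      fun s t _ _ h => ⟨this s t h, this t s h.symm⟩
    rintro s t h ⟨h1, h2⟩
    rw [hnf.nf_neg] at h1 h2
    exact h.2 ⟨(hE.sat _ h2 _ h2).dneg _ rfl, h1⟩
  | imp =>
    suffices ∀ s t s' t' : Term S .o, Compat P nf E .o s t → Compat P nf E .o s' t' →
        ¬ (nf (s.imp s') ∈ E ∧ (nf (t.imp t')).neg ∈ E) from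
      fun s t _ _ h s' t' _ _ h' => ⟨this s t s' t' h h', this t s t' s' h.symm h'.symm⟩
    rintro s t s' t' h h' ⟨h1, h2⟩
    rw [hnf.nf_imp] at h1 h2
    obtain ⟨h3, h4⟩ := (hE.sat _ h2 _ h2).negImp _ _ rfl
    obtain h5 | h5 := (hE.sat _ h1 _ h1).imp _ _ rfl
    · exact h.2 ⟨h3, h5⟩
    · exact h'.1 ⟨h5, h4⟩
  | eq σ =>
    obtain _ | α | _ := σ
    · exact hx.elim
    · suffices ∀ s t s' t' : Term S (.sort α), Compat P nf E _ s t → Compat P nf E _ s' t' →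
          ¬ (nf (s.eq s') ∈ E ∧ (nf (t.eq t')).neg ∈ E) from
        fun s t _ _ h s' t' _ _ h' => ⟨this s t s' t' h h', this t s t' s' h.symm h'.symm⟩
      rintro s t s' t' h h' ⟨h1, h2⟩
      rw [hnf.nf_eq] at h1 h2
      obtain ⟨h3, -⟩ | ⟨-, h3⟩ := (hE.sat _ h1 _ h2).confront _ _ _ _ _ rfl rfl
      · exact h.1 h3
      · exact h'.1 h3
    · exact hx.elim
  | all α =>
    suffices ∀ s t : Term S (.arr (.sort α) .o), Compat P nf E _ s t →
        ¬ (nf s.all ∈ E ∧ (nf t.all).neg ∈ E) from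
      fun s t _ _ h => ⟨this s t h, this t s h.symm⟩
    rintro s t h ⟨h1, h2⟩
    rw [hnf.nf_all] at h1 h2
    obtain ⟨n, hn⟩ := (hE.sat _ h2 _ h2).negAll _ _ rfl
    have refl : ∀ (_ : P) (u : Term S (.sort α)), Compat P nf E _ u u :=
      fun hp u => ⟨hP hp α u, hP hp α u⟩
    have key : ∀ u : Term S (.sort α), nf (.app (nf s) u) ∈ E →
        ¬ Compat P nf E _ u (.var _ n) := by
      intro u hu hun
      rw [hnf.app] at hn hu
      exact (h u (.var _ n) (fun hp => refl hp _) (fun hp => refl hp _) hun).1 ⟨hu, hn⟩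
    by_cases hd : ∃ u : Term S (.sort α), Discriminating E u
    · have inst : ∀ u : Term S (.sort α), Discriminating E u → nf (.app (nf s) u) ∈ E := by
        rintro u ⟨v, hv | hv⟩
        · exact ((hE.sat _ h1 _ hv).allNeq _ _ _ _ rfl rfl).1
        · exact ((hE.sat _ h1 _ hv).allNeq _ _ _ _ rfl rfl).2
      by_cases hx : Discriminating E (Term.var (.sort α) n)
      · exact key _ (inst _ hx) (hE.compat_var hnf P _ n)
      · obtain ⟨u, hu⟩ := hd
        rw [← (hnf.normalEFO_var α n).1] at hx
        exact key u (inst u hu) ⟨fun h' => hx ⟨_, .inr h'⟩, fun h' => hx ⟨_, .inl h'⟩⟩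
    · obtain h3 | ⟨u, hu⟩ := (hE.sat _ h1 _ h1).all _ _ rfl
      · exact hd h3
      · exact key u hu ⟨fun h' => hd ⟨_, _, .inl h'⟩, fun h' => hd ⟨_, _, .inl h'⟩⟩

theorem Subst.upd_self (θ : Subst S) {σ : Ty S} (x : Name S σ) (t : Term S σ) :
    θ.upd x t ⟨σ, x⟩ = some t := by
  classical exact Function.update_self _ _ _

theorem Subst.upd_of_ne (θ : Subst S) {σ : Ty S} {x : Name S σ} (t : Term S σ) {y : AnyName S}
    (h : y ≠ ⟨σ, x⟩) : θ.upd x t y = θ y := by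
  classical exact Function.update_of_ne h _ _

theorem compat_hat (hnf : IsNormalization nf) {hat : Subst S → TermMap S}
    (hhat : IsSubstExtension nf hat) {σ : Ty S} (s : Term S σ) (hs : s.IsEFO) :
    ∀ θ θ' : Subst S,
      (∀ (σ : Ty S) (x : Name S σ), x.IsEFO →
        (P → Compat P nf E σ ((θ ⟨σ, x⟩).getD (.name x)) ((θ ⟨σ, x⟩).getD (.name x))) ∧
        (P → Compat P nf E σ ((θ' ⟨σ, x⟩).getD (.name x)) ((θ' ⟨σ, x⟩).getD (.name x))) ∧
        Compat P nf E σ ((θ ⟨σ, x⟩).getD (.name x)) ((θ' ⟨σ, x⟩).getD (.name x))) →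
      Compat P nf E σ (hat θ s) (hat θ' s) := by
  induction s with
  | name x =>
    intro θ θ' h
    rw [hhat.name, hhat.name]
    exact (h _ x hs).2.2
  | app s t ihs iht =>
    intro θ θ' h
    rw [hhat.app, hhat.app]
    refine ihs hs.1 θ θ' h _ _ (fun hP => iht hs.2 θ θ ?_) (fun hP => iht hs.2 θ' θ' ?_)
      (iht hs.2 θ θ' h)
    · exact fun σ x hx => ⟨(h σ x hx).1, (h σ x hx).1, (h σ x hx).1 hP⟩
    · exact fun σ x hx => ⟨(h σ x hx).2.1, (h σ x hx).2.1, (h σ x hx).2.1 hP⟩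
  | lam x s ih =>
    intro θ θ' h u v hu hv huv
    refine (ih hs.2 (θ.upd x u) (θ'.upd x v) fun σ y hy => ?_).congr hnf
      (hhat.lam _ _ _ _ _ _).symm (hhat.lam _ _ _ _ _ _).symm
    by_cases e : (⟨σ, y⟩ : AnyName S) = ⟨_, x⟩
    · cases e
      simpa only [Subst.upd_self] using ⟨hu, hv, huv⟩
    · simpa only [Subst.upd_of_ne _ _ e] using h σ y hy

theorem Evident.neq_self_not_mem (hE : Evident nf E) (hnf : IsNormalization nf) {α : S}
    (s : Term S (.sort α)) : s.neq s ∉ E := by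
  intro h
  obtain ⟨hs, -⟩ := hnf.admissible_neq.1 (hE.branch _ h)
  obtain ⟨hat, hhat⟩ := hnf.subst
  have := (compat_hat (P := False) (E := E) hnf hhat s hs.2 (fun _ => none) (fun _ => none)
    fun σ x hx => ⟨False.elim, False.elim, hE.compat_name hnf False.elim x hx⟩).neq_not_mem hE hnf
  rw [hhat.empty, hs.1] at this
  exact this h

/-! ### Discriminants and values -/

/-- Sets of discriminating terms no two of which are separated by a disequation in `E`. -/
def IsPrediscriminant (E : Set (Term S .o)) {α : S} (a : Set (Term S (.sort α))) : Prop :=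
  (∀ u ∈ a, Discriminating E u) ∧ ∀ u ∈ a, ∀ v ∈ a, u.neq v ∉ E

/-- Discriminants, the maximal sets of unseparated discriminating terms, serve as individuals. -/
def Discriminant (E : Set (Term S .o)) (α : S) : Type :=
  {a : Set (Term S (.sort α)) // Maximal (IsPrediscriminant E) a}

theorem IsPrediscriminant.exists_discriminant {α : S} {a : Set (Term S (.sort α))}
    (h : IsPrediscriminant E a) : ∃ b : Discriminant E α, a ⊆ b.1 := by
  obtain ⟨b, hab, hb⟩ := zorn_subset_nonempty {a | IsPrediscriminant E a} (fun c hc hchain _ => by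
    refine ⟨⋃₀ c, ⟨?_, ?_⟩, fun s hs => Set.subset_sUnion_of_mem hs⟩
    · rintro u ⟨b, hb, hu⟩
      exact (hc hb).1 u hu
    · rintro u ⟨b, hb, hu⟩ v ⟨b', hb', hv⟩
      obtain h | h := hchain.total hb hb'
      · exact (hc hb').2 u (h hu) v hv
      · exact (hc hb).2 u hu v (h hv)) a h
  exact ⟨⟨b, hb⟩, hab⟩

/-- The standard domains over the discriminants of `E`. -/
def Val (E : Set (Term S .o)) : Ty S → Type
  | .o => Bool
  | .sort α => Discriminant E α
  | .arr σ τ => Val E σ → Val E τ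

theorem nonempty_val (E : Set (Term S .o)) : ∀ σ, Nonempty (Val E σ)
  | .o => ⟨true⟩
  | .sort α =>
    let ⟨b, _⟩ := IsPrediscriminant.exists_discriminant (E := E) (α := α) (a := ∅)
      ⟨by simp, by simp⟩
    ⟨b⟩
  | .arr σ τ => let ⟨b⟩ := nonempty_val E τ; ⟨fun _ => b⟩

/-- `a` is a possible value of the term `s`. -/
def Possible (nf : TermMap S) (E : Set (Term S .o)) : (σ : Ty S) → Term S σ → Val E σ → Prop
  | .o, s, b => (nf s ∈ E → b = true) ∧ ((nf s).neg ∈ E → b = false)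
  | .sort _, s, a => Discriminating E (nf s) → nf s ∈ a.1
  | .arr σ τ, s, f => ∀ (t : Term S σ) (a : Val E σ),
      Possible nf E σ t a → Possible nf E τ (.app s t) (f a)

theorem Possible.congr (hnf : IsNormalization nf) : ∀ {σ : Ty S} {s s' : Term S σ} {a : Val E σ},
    nf s = nf s' → Possible nf E σ s a → Possible nf E σ s' a
  | .o, _, _, _, hs, h => by simpa only [Possible, hs] using h
  | .sort _, _, _, _, hs, h => by simpa only [Possible, hs] using h
  | .arr _ _, _, _, _, hs, h => fun t a ht => (h t a ht).congr hnf (hnf.nf_app_congr hs t)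

theorem Evident.possible_aux (hE : Evident nf E) (hnf : IsNormalization nf) : ∀ σ : Ty S,
    (∀ T : Set (Term S σ), (∀ s ∈ T, ∀ t ∈ T, Compat True nf E σ s t) →
      ∃ a, ∀ s ∈ T, Possible nf E σ s a) ∧
    ∀ (s t : Term S σ) (a : Val E σ), Possible nf E σ s a → Possible nf E σ t a →
      Compat True nf E σ s t
  | .o => by
    refine ⟨fun T hT => ?_, fun s t a hs ht => ?_⟩
    · by_cases h : ∃ t ∈ T, nf t ∈ E
      · obtain ⟨t, ht, h⟩ := h
        exact ⟨true, fun s hs => ⟨fun _ => rfl, fun h' => ((hT s hs t ht).2 ⟨h, h'⟩).elim⟩⟩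
      · exact ⟨false, fun s hs => ⟨fun h' => (h ⟨s, hs, h'⟩).elim, fun _ => rfl⟩⟩
    · refine ⟨fun h => ?_, fun h => ?_⟩
      · exact absurd ((hs.1 h.1).symm.trans (ht.2 h.2)) (by simp)
      · exact absurd ((ht.1 h.1).symm.trans (hs.2 h.2)) (by simp)
  | .sort α => by
    refine ⟨fun T hT => ?_, fun s t a hs ht => ?_⟩
    · obtain ⟨a, ha⟩ := IsPrediscriminant.exists_discriminant (E := E)
        (a := {u | Discriminating E u ∧ ∃ s ∈ T, nf s = u}) ⟨fun u hu => hu.1, by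
          rintro _ ⟨-, s, hs, rfl⟩ _ ⟨-, t, ht, rfl⟩
          exact (hT s hs t ht).1⟩
      exact ⟨a, fun s hs h => ha ⟨h, s, hs, rfl⟩⟩
    · exact ⟨fun h => a.2.prop.2 _ (hs ⟨_, .inl h⟩) _ (ht ⟨_, .inr h⟩) h,
        fun h => a.2.prop.2 _ (ht ⟨_, .inl h⟩) _ (hs ⟨_, .inr h⟩) h⟩
  | .arr σ τ => by
    refine ⟨fun T hT => ?_, fun s t f hs ht u v hu hv huv => ?_⟩
    · have h : ∀ a : Val E σ, ∃ b : Val E τ, ∀ s ∈ T, ∀ u, Possible nf E σ u a →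
          Possible nf E τ (.app s u) b := by
        intro a
        obtain ⟨b, hb⟩ := (hE.possible_aux hnf τ).1
          {r | ∃ s ∈ T, ∃ u, Possible nf E σ u a ∧ r = .app s u} (by
            rintro _ ⟨s, hs, u, hu, rfl⟩ _ ⟨t, ht, v, hv, rfl⟩
            have := (hE.possible_aux hnf σ).2
            exact hT s hs t ht u v (fun _ => this _ _ _ hu hu) (fun _ => this _ _ _ hv hv)
              (this _ _ _ hu hv))
        exact ⟨b, fun s hs u hu => hb _ ⟨s, hs, u, hu, rfl⟩⟩
      choose f hf using h
      exact ⟨f, fun s hs u a hu => hf a s hs u hu⟩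
    · obtain ⟨a, ha⟩ := (hE.possible_aux hnf σ).1 {u, v} (by
        rintro _ (rfl | rfl) _ (rfl | rfl)
        exacts [hu True.intro, huv, huv.symm, hv True.intro])
      exact (hE.possible_aux hnf τ).2 _ _ (f a) (hs u a (ha u (by simp))) (ht v a (ha v (by simp)))

theorem Evident.exists_possible_var (hE : Evident nf E) (hnf : IsNormalization nf) (σ : Ty S)
    (n : ℕ) : ∃ a, Possible nf E σ (.var σ n) a := by
  obtain ⟨a, ha⟩ := (hE.possible_aux hnf σ).1 {.var σ n} (by
    rintro _ rfl _ rfl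
    exact hE.compat_var hnf True σ n)
  exact ⟨a, ha _ rfl⟩

/-- Terms with a common possible value are not separated. -/
theorem Possible.neq_not_mem (hE : Evident nf E) (hnf : IsNormalization nf) {σ : Ty S}
    {s t : Term S σ} {a : Val E σ} (hs : Possible nf E σ s a) (ht : Possible nf E σ t a) :
    (nf s).neq (nf t) ∉ E :=
  ((hE.possible_aux hnf σ).2 s t a hs ht).neq_not_mem hE hnf

/-- Discriminants that contain the two sides of an equation, whenever these are discriminating,
are included in each other. -/
theorem Evident.discriminant_subset (hE : Evident nf E) {α : S} {s t : Term S (.sort α)}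
    (hst : s.eq t ∈ E) {a b : Discriminant E α} (ha : Discriminating E s → s ∈ a.1)
    (hb : Discriminating E t → t ∈ b.1) : a.1 ⊆ b.1 := by
  intro u hu
  by_contra hub
  have sep : ∃ v ∈ b.1, u.neq v ∈ E ∨ v.neq u ∈ E := by
    by_contra! h
    refine hub (b.2.le_of_ge (y := insert u b.1) ⟨?_, ?_⟩ (Set.subset_insert _ _)
      (Set.mem_insert _ _))
    · rintro v (rfl | hv)
      · exact a.2.prop.1 v hu
      · exact b.2.prop.1 v hv
    · rintro v (rfl | hv) w (rfl | hw)
      · exact a.2.prop.2 _ hu _ hu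
      · exact (h w hw).1
      · exact (h v hv).2
      · exact b.2.prop.2 v hv w hw
  have hsu : s.neq u ∉ E := fun h => a.2.prop.2 s (ha ⟨u, .inl h⟩) u hu h
  have htv : ∀ v ∈ b.1, t.neq v ∉ E := fun v hv h => b.2.prop.2 t (hb ⟨v, .inl h⟩) v hv h
  obtain ⟨v, hv, h | h⟩ := sep
  · obtain ⟨h', -⟩ | ⟨-, h'⟩ := (hE.sat _ hst _ h).confront _ _ _ _ _ rfl rfl
    exacts [hsu h', htv v hv h']
  · obtain ⟨-, h'⟩ | ⟨h', -⟩ := (hE.sat _ hst _ h).confront _ _ _ _ _ rfl rfl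
    exacts [htv v hv h', hsu h']

theorem Evident.discriminant_eq (hE : Evident nf E) {α : S} {s t : Term S (.sort α)}
    (hst : s.eq t ∈ E) {a b : Discriminant E α} (ha : Discriminating E s → s ∈ a.1)
    (hb : Discriminating E t → t ∈ b.1) : a = b :=
  Subtype.ext (a.2.eq_of_subset b.2.prop (hE.discriminant_subset hst ha hb))

/-- A discriminant is empty only if there are no discriminating terms. -/
theorem Evident.discriminant_nonempty (hE : Evident nf E) (hnf : IsNormalization nf) {α : S}
    {u : Term S (.sort α)} (hu : Discriminating E u) (a : Discriminant E α) : a.1.Nonempty := by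
  by_contra h
  rw [Set.not_nonempty_iff_eq_empty] at h
  have := a.2.le_of_ge (y := {u}) ⟨by rintro _ rfl; exact hu, by
    rintro _ rfl _ rfl
    exact hE.neq_self_not_mem hnf _⟩ (by simp [h])
  simpa [h] using this (Set.mem_singleton u)

/-! ### The model -/

open Classical in
/-- The logical interpretation that gives the variables the values `v`. -/
noncomputable def interp (v : ∀ σ : Ty S, ℕ → Val E σ) : (x : AnyName S) → Val E x.1
  | ⟨_, .var σ n⟩ => v σ n
  | ⟨_, .neg⟩ => fun a : Bool => (!a : Bool)
  | ⟨_, .imp⟩ => fun a b : Bool => (!a || b : Bool)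
  | ⟨_, .eq _⟩ => fun a b => (decide (a = b) : Bool)
  | ⟨_, .all α⟩ => fun f : Discriminant E α → Bool => (decide (∀ a, f a = true) : Bool)

theorem Evident.possible_name (hE : Evident nf E) (hnf : IsNormalization nf)
    {v : ∀ σ : Ty S, ℕ → Val E σ} (hv : ∀ σ n, Possible nf E σ (.var σ n) (v σ n)) {σ : Ty S}
    (x : Name S σ) (hx : x.IsEFO) : Possible nf E σ (.name x) (interp v ⟨σ, x⟩) := by
  cases x with
  | var σ n => exact hv σ n
  | neg =>
    intro s (a : Bool) h
    change (nf s.neg ∈ E → (!a) = true) ∧ ((nf s.neg).neg ∈ E → (!a) = false)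
    rw [hnf.nf_neg]
    refine ⟨fun h' => by simp [show a = false from h.2 h'], fun h' => ?_⟩
    simp [show a = true from h.1 ((hE.sat _ h' _ h').dneg _ rfl)]
  | imp =>
    intro s (a : Bool) hs t (b : Bool) ht
    change (nf (s.imp t) ∈ E → (!a || b) = true) ∧ ((nf (s.imp t)).neg ∈ E → (!a || b) = false)
    rw [hnf.nf_imp]
    refine ⟨fun h => ?_, fun h => ?_⟩
    · obtain h | h := (hE.sat _ h _ h).imp _ _ rfl
      · simp [show a = false from hs.2 h]
      · simp [show b = true from ht.1 h]
    · obtain ⟨h1, h2⟩ := (hE.sat _ h _ h).negImp _ _ rfl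
      simp [show a = true from hs.1 h1, show b = false from ht.2 h2]
  | eq σ =>
    obtain _ | α | _ := σ
    · exact hx.elim
    · classical
      intro s a hs t b ht
      have : (nf (s.eq t) ∈ E → a = b) ∧ ((nf (s.eq t)).neg ∈ E → a ≠ b) := by
        rw [hnf.nf_eq]
        refine ⟨fun h => hE.discriminant_eq h hs ht, ?_⟩
        rintro h rfl
        exact Possible.neq_not_mem hE hnf hs ht h
      exact ⟨fun h => decide_eq_true (this.1 h), fun h => decide_eq_false (this.2 h)⟩
    · exact hx.elim
  | all α =>
    classical
    intro s (f : Discriminant E α → Bool) hs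
    have : (nf s.all ∈ E → ∀ a, f a = true) ∧ ((nf s.all).neg ∈ E → ¬ ∀ a, f a = true) := by
      rw [hnf.nf_all]
      refine ⟨fun h a => ?_, fun h h' => ?_⟩
      · by_cases hd : ∃ u : Term S (.sort α), Discriminating E u
        · obtain ⟨u, hu⟩ := hd
          obtain ⟨u, hu⟩ := hE.discriminant_nonempty hnf hu a
          have key : nf u = u ∧ nf (.app (nf s) u) ∈ E := by
            obtain ⟨v, hv | hv⟩ := a.2.prop.1 u hu
            · exact ⟨(hnf.admissible_neq.1 (hE.branch _ hv)).1.1,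
                ((hE.sat _ h _ hv).allNeq _ _ _ _ rfl rfl).1⟩
            · exact ⟨(hnf.admissible_neq.1 (hE.branch _ hv)).2.1,
                ((hE.sat _ h _ hv).allNeq _ _ _ _ rfl rfl).2⟩
          rw [hnf.app] at key
          refine (hs u a fun _ => ?_).1 key.2
          rwa [key.1]
        · obtain h' | ⟨u, hu⟩ := (hE.sat _ h _ h).all _ _ rfl
          · exact (hd h').elim
          · rw [hnf.app] at hu
            exact (hs u a fun h' => (hd ⟨_, h'⟩).elim).1 hu
      · obtain ⟨n, hn⟩ := (hE.sat _ h _ h).negAll _ _ rfl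
        rw [hnf.app] at hn
        have h1 : f (v (.sort α) n) = false := (hs _ _ (hv _ n)).2 hn
        exact absurd (h1.symm.trans (h' _)) (by simp)
    exact ⟨fun h => decide_eq_true (this.1 h), fun h => decide_eq_false (this.2 h)⟩

/-- The standard frame of discriminants. -/
def discriminantFrame (E : Set (Term S .o)) : Frame S where
  dom := Val E
  nonempty := nonempty_val E
  app f := f
  ext _ _ h := h

/-- The value of a term in the standard frame of discriminants. -/
noncomputable def eval : {σ : Ty S} → Term S σ → Assignment (discriminantFrame E) → Val E σ
  | _, .name x, I => I ⟨_, x⟩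
  | _, .app (σ := σ) (τ := τ) s t, I => (eval s I : Val E σ → Val E τ) (eval t I)
  | _, .lam x t, I => fun a => eval t (I.upd x a)

theorem evaluates_eval {σ : Ty S} (s : Term S σ) :
    ∀ I : Assignment (discriminantFrame E), Evaluates (discriminantFrame E) s I (eval s I) := by
  induction s with
  | name x => exact fun I => rfl
  | app s t hs ht => exact fun I => ⟨_, _, hs I, ht I, rfl⟩
  | lam x t ht => exact fun I a => ht _

theorem Assignment.upd_self {F : Frame S} (I : Assignment F) {σ : Ty S} (x : Name S σ)
    (a : F.dom σ) : I.upd x a ⟨σ, x⟩ = a := by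
  classical exact Function.update_self _ _ _

theorem Assignment.upd_of_ne {F : Frame S} (I : Assignment F) {σ : Ty S} {x : Name S σ}
    (a : F.dom σ) {y : AnyName S} (h : y ≠ ⟨σ, x⟩) : I.upd x a y = I y := by
  classical exact Function.update_of_ne h _ _

theorem possible_hat (hnf : IsNormalization nf) {hat : Subst S → TermMap S}
    (hhat : IsSubstExtension nf hat) {σ : Ty S} (s : Term S σ) (hs : s.IsEFO) :
    ∀ (θ : Subst S) (I : Assignment (discriminantFrame E)),
      (∀ (σ : Ty S) (x : Name S σ), x.IsEFO →
        Possible nf E σ ((θ ⟨σ, x⟩).getD (.name x)) (I ⟨σ, x⟩)) →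
      Possible nf E σ (hat θ s) (eval s I) := by
  induction s with
  | name x =>
    intro θ I h
    rw [hhat.name]
    exact h _ x hs
  | app s t ihs iht =>
    intro θ I h
    rw [hhat.app]
    exact ihs hs.1 θ I h _ _ (iht hs.2 θ I h)
  | lam x s ih =>
    intro θ I h u (a : (discriminantFrame E).dom _) hu
    refine (ih hs.2 (θ.upd x u) (I.upd x a) fun σ y hy => ?_).congr hnf
      (hhat.lam _ _ _ _ _ _).symm
    by_cases e : (⟨σ, y⟩ : AnyName S) = ⟨_, x⟩
    · cases e
      rw [Subst.upd_self, Assignment.upd_self]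
      exact hu
    · rw [Subst.upd_of_ne _ _ e, Assignment.upd_of_ne _ _ e]
      exact h σ y hy

theorem isLogical_interp (v : ∀ σ : Ty S, ℕ → Val E σ) :
    IsLogical (discriminantFrame E) (Equiv.refl Bool) (interp v) where
  neg := show ∀ a : Bool, (!a) = true ↔ ¬ a = true by decide
  imp := show ∀ a b : Bool, (!a || b) = true ↔ (a = true → b = true) by decide
  eq σ a b := by
    classical exact decide_eq_true_iff
  all α f := by
    classical exact decide_eq_true_iff

theorem Evident.hasStandardModel (hE : Evident nf E) (hnf : IsNormalization nf) :
    HasStandardModel E := by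
  obtain ⟨hat, hhat⟩ := hnf.subst
  choose v hv using hE.exists_possible_var hnf
  have poss : ∀ {σ : Ty S} (s : Term S σ), NormalEFO nf s → nf s = s ∧
      Possible nf E σ s (eval s (interp v)) := fun s hs =>
    ⟨hs.1, (possible_hat hnf hhat s hs.2 (fun _ => none) (interp v)
      fun σ x hx => hE.possible_name hnf hv x hx).congr hnf (hhat.empty _ s)⟩
  have logical := isLogical_interp v
  refine ⟨discriminantFrame E, interp v, fun σ τ f => ⟨f, rfl⟩,
    fun σ s => ⟨_, evaluates_eval s _⟩, Equiv.refl Bool, logical,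
    fun s hs => ⟨_, evaluates_eval s _, ?_⟩⟩
  obtain ⟨h, h' | ⟨σ, t, u, -, -, rfl⟩⟩ := hE.branch s hs
  · have := (poss s ⟨h, h'⟩).2.1
    rw [h] at this
    exact this hs
  · obtain ⟨ht, hu⟩ := hnf.admissible_neq.1 (hE.branch _ hs)
    refine (logical.neg _).2 fun h => ?_
    have h := (logical.eq σ (eval t (interp v)) (eval u (interp v))).1 h
    obtain ⟨ht, ht'⟩ := poss t ht
    obtain ⟨hu, hu'⟩ := poss u hu
    rw [← h] at hu'
    have := ht'.neq_not_mem hE hnf hu'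
    rw [ht, hu] at this
    exact this hs

end

end STT

theorem mainTheorem7 (S : Type) [Countable S] (nf : STT.TermMap S)
    (hnf : STT.IsNormalization nf)
    (hEFO : ∀ (σ : STT.Ty S) (s : STT.Term S σ), s.IsEFO → (nf s).IsEFO)
    (A : Set (STT.Term S STT.Ty.o)) (hfin : A.Finite) (hA : STT.IsEFOBranch nf A) :
    STT.Refutable nf A ∨ STT.HasStandardModel A := by
  refine or_iff_not_imp_left.2 fun h => ?_
  obtain ⟨E, hAE, hE⟩ := STT.Consistent.exists_evident hnf hEFO ⟨hfin, hA, h⟩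
  obtain ⟨F, I, hF, hI, tv, htv, hE⟩ := hE.hasStandardModel hnf
  exact ⟨F, I, hF, hI, tv, htv, fun s hs => hE s (hAE hs)⟩
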